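/- Write $\Gamma_{\mathbb C}(s)=2(2\pi)^{-s}\Gamma(s)$. Let $$\gamma(s)=Q^s\prod_{j=1}^r\Gamma(\lambda_j s+\mu_j),$$ where $Q,\lambda_1,\dots,\lambda_r\in\mathbb R_{>0}$, $\mu_j\in\mathbb C$ with $\operatorname{Re}(\mu_j)>-\tfrac12\lambda_j$ for all $j$, and $\sum_{j=1}^r\lambda_j=1$. For real $\lambda\ge\frac92$, $x>0$, $\operatorname{Re}(s)\in\left(\frac12,\frac{\lambda-1}{2}\right)$ and $\sigma_1\in\left(\frac{1-\lambda}{2},-\operatorname{Re}(s)\right)$ set $$F_\lambda(s,x)=\frac1{2\pi i}\int_{\operatorname{Re}(u)=\sigma_1}\frac{\Gamma_{\mathbb C}\left(u+\frac{\lambda-1}2\right)\gamma(1-s-u)}{\Gamma_{\mathbb C}\left(-u+\frac{\lambda+1}2\right)\gamma(s+u)}\,x^u\,du,$$ which does not depend on the choice of $\sigma_1$. Let $\delta$ be an odd residue class modulo $4$, and suppose that $F_\lambda(1,1)=0$ for every half-integer $\lambda\ge\frac92$ with $2\lambda\equiv\delta\pmod 4$. Then there exist $\nu\in\left\{\frac12,\frac32,\frac52,\frac72\right\}$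 with $2\nu\equiv\delta\pmod 4$ and real constants $C,H>0$ such that, as meromorphic functions of $s$, $$\gamma(s)=C\,H^s\,\Gamma_{\mathbb C}\left(s+\frac{\nu-1}{2}\right).$$ -/

import Mathlib

noncomputable section

/-- The gamma factor `γ(s) = Q ^ s * ∏ j, Γ(l j * s + μ j)`.  At a pole some factor takes the
Mathlib value `0`, so `gammaFactor` is `0` there; since `Γ` has no zeros, `1 / gammaFactor` is
the entire function `1 / γ`, with the correct value at every point. -/
def gammaFactor {r : ℕ} (Q : ℝ) (l : Fin r → ℝ) (μ : Fin r → ℂ) (s : ℂ) : ℂ :=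
  (Q : ℂ) ^ s * ∏ j, Complex.Gamma ((l j : ℂ) * s + μ j)

/-- The integrand of the Mellin–Barnes integral `F_lam(s, x)` attached to `γ`. -/
def mellinBarnesIntegrand (γ : ℂ → ℂ) (lam : ℝ) (s : ℂ) (x : ℝ) (u : ℂ) : ℂ :=
  (Complex.Gammaℂ (u + ((lam : ℂ) - 1) / 2) * γ (1 - s - u)) /
      (Complex.Gammaℂ (-u + ((lam : ℂ) + 1) / 2) * γ (s + u)) * (x : ℂ) ^ u

/-- `F_lam(s, x) = (1 / (2πi)) ∫_{Re u = σ₁} … x ^ u du`, taken over the vertical line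
`u = σ₁ + i t`, `du = i dt`. The line is admissible when `(1 - lam) / 2 < σ₁ < - Re s`. -/
def mellinBarnes (γ : ℂ → ℂ) (lam : ℝ) (s : ℂ) (x : ℝ) (σ₁ : ℝ) : ℂ :=
  1 / (2 * (Real.pi : ℂ) * Complex.I) *
    ∫ t : ℝ, mellinBarnesIntegrand γ lam s x ((σ₁ : ℂ) + (t : ℂ) * Complex.I) * Complex.I

/-- `2 x` is an integer congruent to `δ` modulo `4`. -/
def TwiceModFour (x : ℝ) (δ : ℤ) : Prop :=
  ∃ k : ℤ, 2 * x = (k : ℝ) ∧ k ≡ δ [ZMOD 4]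

end

/-! Put `a = (lam - 1) / 2` and let K_a(u) = Γ_ℂ(u+a) γ(-u) / (Γ_ℂ(a+1-u) γ(1+u)) be the integrand
at s = x = 1. Since the λ_j sum to 1, Stirling's formula gives K_a quadratic decay in vertical
strips, so every contour can be moved to Re u = -1. Replacing λ by λ + 2 multiplies K_a by
(u+a)/(a+1-u). Hence the hypothesis for λ, λ+2, λ+4, … says that a single kernel K_a is orthogonal
to all (u+a)_k/(a+1-u)_k. These span the bounded rational functions with simple poles in a+1, a+2,
…, among them 1/(a+1+n-u) = ∫₀¹ xⁿ x^(a-u) dx. So all moments on [0,1] of x ↦ ∫ K_a(u) x^(a-u) du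
vanish, and the inverse Mellin transform of K_a is zero on (0,1]. Its Mellin transform therefore
converges in a whole left half-plane and continues K_a there. But Γ_ℂ(u+a) has poles at u = -a-n,
and only 1/γ(1+u) can cancel them: γ has poles at 1-a-n (`gammaFactor_eq_zero_of_mellinBarnes`).

With c = a-1, these are the poles of Γ(s+c), so e^(κs)/γ(s) = f(s)/Γ(s+c) with f entire, κ being
`gammaRate`. Stirling on the right and reflection on the left bound f polynomially, and f is a
polynomial P (`exists_polynomial_gammaFactor_inv`).

It remains to use the shape of γ. All but finitely many poles of each Γ(λ_j s + μ_j) are poles of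
Γ(s+c), which forces 1/λ_j ∈ ℕ and μ_j = λ_j(c+d) with an integer d ≥ -1. A multiple pole of γ would
recur periodically to the left and give P infinitely many zeros, so the poles of γ are simple. A
zero of P is then a pole of γ but not of Γ(s+c), and the only candidate is 1-c. Hence γ is an
exponential times Γ(s+c) or Γ(s+c-1) (`exists_gammaFactor_inv_eq`); the smallest admissible λ gives
the list of ν. -/

/-! ### Stirling's formula for log |Γ| -/

section Stirling

open Complex Filter Topology Asymptotics

/-- The error term in Stirling's formula for `log ‖Γ w‖`. -/
noncomputable def stirlingRemainder (w : ℂ) : ℝ :=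
  Real.log ‖Gamma w‖ - ((w - 1 / 2) * log w - w).re

lemma log_add_one_eq {w : ℂ} (hw : 0 < w.re) : log (w + 1) = log w + log (1 + w⁻¹) := by
  have hw0 : w ≠ 0 := by rintro rfl; simp at hw
  have h1 : w + 1 = w * (1 + w⁻¹) := by field_simp
  have hre : 0 < (1 + w⁻¹).re := by
    rw [add_re, one_re, inv_re]
    have := normSq_pos.2 hw0
    positivity
  have hne : 1 + w⁻¹ ≠ 0 := fun h => by simp [h] at hre
  rw [h1, Complex.log_mul hw0 hne]
  have a1 := abs_lt.1 (abs_arg_lt_pi_div_two_iff.2 (Or.inl hw))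
  have a2 := abs_lt.1 (abs_arg_lt_pi_div_two_iff.2 (Or.inl hre))
  constructor <;> linarith [a1.1, a1.2, a2.1, a2.2]

/-- The shift by 1/2 cancels the term of order 1/w: (w + 1/2)(1/w - 1/(2w²)) = 1 - 1/(4w²). -/
lemma norm_add_half_mul_log_sub_one_le {w : ℂ} (hw : 2 ≤ ‖w‖) :
    ‖(w + 1 / 2) * log (1 + w⁻¹) - 1‖ ≤ 2 / ‖w‖ ^ 2 := by
  have hpos : 0 < ‖w‖ := by linarith
  have hw0 : w ≠ 0 := norm_pos_iff.1 hpos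
  have hinv : ‖w⁻¹‖ ≤ 1 / 2 := by
    rw [norm_inv, inv_le_comm₀ hpos (by norm_num)]; simpa using hw
  have hT := norm_log_sub_logTaylor_le 2 (z := w⁻¹) (by linarith)
  have hlt : logTaylor (2 + 1) w⁻¹ = w⁻¹ - w⁻¹ ^ 2 / 2 := by
    simp [logTaylor, Finset.sum_range_succ]; ring
  rw [hlt] at hT
  have hT' : ‖log (1 + w⁻¹) - (w⁻¹ - w⁻¹ ^ 2 / 2)‖ ≤ 2 / 3 * ‖w‖⁻¹ ^ 3 := by
    refine hT.trans ?_
    have : (1 - ‖w⁻¹‖)⁻¹ ≤ 2 := by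
      rw [inv_le_comm₀ (by linarith) (by norm_num)]; linarith
    rw [norm_inv] at *
    have h3 : 0 ≤ ‖w‖⁻¹ ^ (2 + 1) := by positivity
    push_cast
    nlinarith
  have key : (w + 1 / 2) * log (1 + w⁻¹) - 1 =
      (w + 1 / 2) * (log (1 + w⁻¹) - (w⁻¹ - w⁻¹ ^ 2 / 2)) - w⁻¹ ^ 2 / 4 := by
    field_simp; ring
  have hhalf : ‖w + 1 / 2‖ ≤ 5 / 4 * ‖w‖ := by
    refine (norm_add_le _ _).trans ?_
    have : ‖(1 / 2 : ℂ)‖ = 1 / 2 := by simp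
    rw [this]; linarith
  rw [key]
  calc _ ≤ ‖w + 1 / 2‖ * ‖log (1 + w⁻¹) - (w⁻¹ - w⁻¹ ^ 2 / 2)‖ + ‖w⁻¹ ^ 2 / 4‖ := by
        refine (norm_sub_le _ _).trans ?_
        rw [norm_mul]
    _ ≤ (5 / 4 * ‖w‖) * (2 / 3 * ‖w‖⁻¹ ^ 3) + ‖w‖⁻¹ ^ 2 / 4 := by
        gcongr
        simp
    _ ≤ 2 / ‖w‖ ^ 2 := by
        have e : (5 / 4 * ‖w‖) * (2 / 3 * ‖w‖⁻¹ ^ 3) + ‖w‖⁻¹ ^ 2 / 4 =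
            (13 / 12) / ‖w‖ ^ 2 := by
          field_simp; norm_num
        rw [e]; gcongr; norm_num

lemma stirlingRemainder_add_one {w : ℂ} (hw : 0 < w.re) :
    stirlingRemainder (w + 1) =
      stirlingRemainder w - ((w + 1 / 2) * log (1 + w⁻¹) - 1).re := by
  have hw0 : w ≠ 0 := by rintro rfl; simp at hw
  have hG : ‖Gamma w‖ ≠ 0 := norm_ne_zero_iff.2 (Gamma_ne_zero_of_re_pos hw)
  rw [stirlingRemainder, stirlingRemainder, Gamma_add_one w hw0, norm_mul,
    Real.log_mul (norm_ne_zero_iff.2 hw0) hG, ← log_re w, log_add_one_eq hw]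
  have : (w + 1 - 1 / 2) * (log w + log (1 + w⁻¹)) - (w + 1) =
      ((w - 1 / 2) * log w - w) + ((w + 1 / 2) * log (1 + w⁻¹) - 1) + log w := by ring
  rw [this, add_re, add_re]
  ring

lemma abs_stirlingRemainder_add_nat_sub_le {w : ℂ} (hw : 2 ≤ w.re) (N : ℕ) :
    |stirlingRemainder (w + N) - stirlingRemainder w| ≤ 2 * (1 - 1 / ((N : ℝ) + 1)) := by
  induction N with
  | zero => simp
  | succ N ih =>
    have hre : (N : ℝ) + 2 ≤ (w + N).re := by simp; linarith
    have hN : (0 : ℝ) ≤ N := N.cast_nonneg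
    have hnorm : (N : ℝ) + 2 ≤ ‖w + N‖ := hre.trans (re_le_norm _)
    have h1 := stirlingRemainder_add_one (w := w + N) (by linarith)
    have h2 := norm_add_half_mul_log_sub_one_le (w := w + N) (by linarith)
    have h3 := (abs_re_le_norm _).trans h2
    -- The increments are dominated by a telescoping series, so the total is bounded uniformly in
    -- `w` and `N`.
    have h4 : 2 / ‖w + N‖ ^ 2 ≤ 2 * (1 / ((N : ℝ) + 1) - 1 / ((N : ℝ) + 1 + 1)) := by
      have : 2 / ‖w + N‖ ^ 2 ≤ 2 / ((N : ℝ) + 2) ^ 2 := by gcongr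
      refine this.trans ?_
      rw [div_sub_div _ _ (by positivity) (by positivity), mul_div_assoc', div_le_div_iff₀
        (by positivity) (by positivity)]
      nlinarith
    have e : w + ((N + 1 : ℕ) : ℂ) = w + N + 1 := by push_cast; ring
    rw [e, h1]
    push_cast
    rw [abs_le] at *
    constructor <;> linarith [h3.1, h3.2, ih.1, ih.2]

lemma tendsto_log_factorial_sub :
    Tendsto (fun N : ℕ => Real.log (N.factorial : ℝ) - ((N + 1 / 2) * Real.log N - N)) atTop
      (𝓝 (Real.log (√Real.pi) + 1 / 2 * Real.log 2)) := by
  have h := (Stirling.tendsto_stirlingSeq_sqrt_pi.log (by positivity)).add_const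
    (1 / 2 * Real.log 2)
  refine h.congr' ?_
  filter_upwards [eventually_gt_atTop 0] with N hN
  have hN' : (N : ℝ) ≠ 0 := by positivity
  rw [Stirling.log_stirlingSeq_formula, Real.log_mul two_ne_zero hN',
    Real.log_div hN' (Real.exp_ne_zero _), Real.log_exp]
  ring

lemma Gamma_add_nat_eq_mul_prod {w : ℂ} (hw : ∀ k : ℕ, w ≠ -k) (n : ℕ) :
    Gamma (w + n) = Gamma w * ∏ j ∈ Finset.range n, (w + j) := by
  induction n with
  | zero => simp
  | succ n ih =>
    have hne : w + n ≠ 0 := fun h => hw n (eq_neg_of_add_eq_zero_left h)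
    rw [Finset.prod_range_succ, ← mul_assoc, ← ih, Nat.cast_succ, ← add_assoc,
      Gamma_add_one _ hne, mul_comm]

/-- Euler's limit: the denominator of `GammaSeq w N` is Γ(w+N+1)/Γ(w), so the expression is log
|Γ(w)| - log |`GammaSeq w N`|. -/
lemma tendsto_log_norm_Gamma_add_nat_sub {w : ℂ} (hw : 0 < w.re) :
    Tendsto (fun N : ℕ => Real.log ‖Gamma (w + (N + 1 : ℕ))‖ -
      (w.re * Real.log N + Real.log (N.factorial : ℝ))) atTop (𝓝 0) := by
  have hG : Gamma w ≠ 0 := Gamma_ne_zero_of_re_pos hw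
  have h1 : Tendsto (fun N : ℕ => Real.log ‖Gamma w‖ - Real.log ‖GammaSeq w N‖) atTop
      (𝓝 (Real.log ‖Gamma w‖ - Real.log ‖Gamma w‖)) :=
    ((GammaSeq_tendsto_Gamma w).norm.log (norm_ne_zero_iff.2 hG)).const_sub _
  rw [sub_self] at h1
  refine h1.congr' ?_
  filter_upwards [eventually_gt_atTop 0] with N hN
  have hpos : ∀ k : ℕ, w ≠ -k := fun k h => by
    rw [h] at hw
    simp at hw
    linarith [(Nat.cast_nonneg k : (0 : ℝ) ≤ k)]
  have hprod := Gamma_add_nat_eq_mul_prod hpos (N + 1)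
  have hne : ∏ j ∈ Finset.range (N + 1), (w + (j : ℂ)) ≠ 0 :=
    Finset.prod_ne_zero_iff.2 fun j _ h => hpos j (eq_neg_of_add_eq_zero_left h)
  have hN' : (0 : ℝ) < N := by exact_mod_cast hN
  have hNn : ‖(N : ℂ) ^ w‖ = (N : ℝ) ^ w.re := by
    rw [← ofReal_natCast, norm_cpow_eq_rpow_re_of_pos hN']
  have hf : ((N.factorial : ℕ) : ℝ) ≠ 0 := by positivity
  rw [hprod, GammaSeq, norm_mul, norm_div, norm_mul, hNn, Real.log_mul (by simpa using hG)
    (norm_ne_zero_iff.2 hne), Real.log_div (by simp; constructor <;> positivity) (norm_ne_zero_iff.2 hne),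
    Real.log_mul (by positivity) (by simpa using hf), Real.log_rpow hN', Complex.norm_natCast]
  ring

lemma tendsto_stirlingRemainder_add_nat {w : ℂ} (hw : 0 < w.re) :
    Tendsto (fun N : ℕ => stirlingRemainder (w + (N + 1 : ℕ))) atTop
      (𝓝 (Real.log (√Real.pi) + 1 / 2 * Real.log 2)) := by
  have hinv : Tendsto (fun n : ℕ => (n : ℂ) * ((w + 1) * (n : ℂ)⁻¹)) atTop (𝓝 (w + 1)) := by
    refine tendsto_const_nhds.congr' ?_
    filter_upwards [eventually_gt_atTop 0] with N hN
    have : (N : ℂ) ≠ 0 := by exact_mod_cast hN.ne'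
    field_simp
  have hsmall : Tendsto (fun n : ℕ => (w + 1) * (n : ℂ)⁻¹) atTop (𝓝 0) := by
    simpa using (tendsto_inv_atTop_nhds_zero_nat (𝕜 := ℂ)).const_mul (w + 1)
  have hlog : Tendsto (fun n : ℕ => log (1 + (w + 1) * (n : ℂ)⁻¹)) atTop (𝓝 0) := by
    have : Tendsto (fun n : ℕ => 1 + (w + 1) * (n : ℂ)⁻¹) atTop (𝓝 1) := by
      simpa using hsmall.const_add 1
    simpa using this.clog (by simp)
  have h3 := ((tendsto_nat_mul_log_one_add_of_tendsto hinv).add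
    (hlog.const_mul (w + 1 / 2))).sub_const (w + 1)
  have h3' := (continuous_re.tendsto _).comp h3
  have h := ((tendsto_log_norm_Gamma_add_nat_sub hw).add tendsto_log_factorial_sub).sub h3'
  simp only [mul_zero, add_zero, sub_self, zero_re, sub_zero, zero_add] at h
  refine h.congr' ?_
  filter_upwards [eventually_gt_atTop 0] with N hN
  have hN' : (0 : ℝ) < N := by exact_mod_cast hN
  have hN0 : (N : ℂ) ≠ 0 := by exact_mod_cast hN.ne'
  have hlogN : log (w + (N + 1 : ℕ)) = Real.log N + log (1 + (w + 1) * (N : ℂ)⁻¹) := by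
    have e : w + (N + 1 : ℕ) = ((N : ℝ) : ℂ) * (1 + (w + 1) * (N : ℂ)⁻¹) := by
      push_cast; field_simp; ring
    rw [e, log_ofReal_mul hN']
    intro h0
    rw [h0, mul_zero] at e
    have := congrArg re e
    simp at this
    linarith
  simp only [Function.comp_apply]
  rw [stirlingRemainder, hlogN]
  have : (w + (N + 1 : ℕ) - 1 / 2) * (Real.log N + log (1 + (w + 1) * (N : ℂ)⁻¹)) -
      (w + (N + 1 : ℕ)) = (w * Real.log N) + (((N + 1 / 2) * Real.log N - N : ℝ) : ℂ) +
      (N * log (1 + (w + 1) * (N : ℂ)⁻¹) + (w + 1 / 2) * log (1 + (w + 1) * (N : ℂ)⁻¹)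
        - (w + 1)) := by
    push_cast; ring
  rw [this, add_re, add_re, ofReal_re, re_mul_ofReal]
  ring

/-- Stirling's formula with bounded error on `2 ≤ re w`. -/
lemma abs_stirlingRemainder_sub_le {w : ℂ} (hw : 2 ≤ w.re) :
    |stirlingRemainder w - (Real.log (√Real.pi) + 1 / 2 * Real.log 2)| ≤ 2 := by
  have h := ((tendsto_stirlingRemainder_add_nat (w := w) (by linarith)).const_sub
    (stirlingRemainder w)).abs
  refine le_of_tendsto h (Eventually.of_forall fun N => ?_)
  rw [abs_sub_comm]
  refine (abs_stirlingRemainder_add_nat_sub_le hw (N + 1)).trans ?_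
  have : (0 : ℝ) ≤ 1 / (((N + 1 : ℕ) : ℝ) + 1) := by positivity
  linarith

end Stirling

/-! ### Growth of γ compared with a single Γ in the right half-plane -/

section StirlingRatio

open Complex Filter Topology Asymptotics

/-- The filter of neighbourhoods of infinity in the closed right half-plane. -/
noncomputable def rightInfty : Filter ℂ := Bornology.cobounded ℂ ⊓ 𝓟 {s | 0 ≤ s.re}

lemma eventually_rightInfty_re : ∀ᶠ s in rightInfty, 0 ≤ s.re :=
  mem_inf_of_right (mem_principal_self _)

lemma tendsto_norm_rightInfty : Tendsto (fun s : ℂ => ‖s‖) rightInfty atTop :=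
  tendsto_norm_cobounded_atTop.mono_left inf_le_left

/-- The main term of Stirling's formula for `log ‖Γ (l * s + m)‖`. -/
noncomputable def stirlingMain (l : ℝ) (m s : ℂ) : ℝ :=
  (l * (s * log s) + l * (Real.log l - 1) * s + (m - 1 / 2) * log s).re

/-- Stirling's formula for `Γ (l * s + m)` as `s → ∞` in the right half-plane. -/
def HasStirling (l : ℝ) (m : ℂ) : Prop :=
  (∀ᶠ s in rightInfty, Gamma (l * s + m) ≠ 0) ∧
    (fun s : ℂ => Real.log ‖Gamma (l * s + m)‖ - stirlingMain l m s) =O[rightInfty]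
      (fun _ => (1 : ℝ))

/-- With z = m/(ls), log(ls+m) = log l + log s + log(1+z). This holds on the principal branch since
Re s ≥ 0 and Re(1+z) > 0. As |s||z| is constant, the term ls·log(1+z) stays bounded. -/
lemma hasStirling_of_two_le {l : ℝ} (hl : 0 < l) {m : ℂ} (hm : 2 ≤ m.re) : HasStirling l m := by
  have hw : ∀ s : ℂ, 0 ≤ s.re → 2 ≤ (l * s + m).re := fun s hs => by
    simp only [add_re, re_ofReal_mul]
    nlinarith
  refine ⟨?_, ?_⟩
  · filter_upwards [eventually_rightInfty_re] with s hs
    exact Gamma_ne_zero_of_re_pos (by linarith [hw s hs])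
  · refine IsBigO.of_bound (2 + |Real.log (√Real.pi) + 1 / 2 * Real.log 2| +
      (‖m - 1 / 2‖ * |Real.log l| + (l + ‖m - 1 / 2‖) * (3 / 2 * (‖m‖ / l)) + ‖m‖)) ?_
    filter_upwards [eventually_rightInfty_re, tendsto_norm_rightInfty.eventually_ge_atTop 1,
      tendsto_norm_rightInfty.eventually_ge_atTop (2 * (‖m‖ / l))] with s hs hs1 hs2
    have hs0 : s ≠ 0 := norm_pos_iff.1 (by linarith)
    have hlC : (l : ℂ) ≠ 0 := by exact_mod_cast hl.ne'
    set z : ℂ := m / (l * s) with hz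
    have hsz : ‖s‖ * ‖z‖ = ‖m‖ / l := by
      rw [hz, norm_div, norm_mul, norm_real, Real.norm_of_nonneg hl.le]
      field_simp
    have hzn : ‖z‖ ≤ 1 / 2 := by
      have : 0 ≤ ‖z‖ := norm_nonneg z
      nlinarith
    have hz1 : ‖z‖ ≤ ‖m‖ / l := by nlinarith [norm_nonneg z]
    have hre : 0 < (1 + z).re := by
      have := (abs_le.1 ((abs_re_le_norm z).trans hzn)).1
      simp; linarith
    have hlog : log (l * s + m) = Real.log l + log s + log (1 + z) := by
      have e : l * s + m = (l : ℂ) * (s * (1 + z)) := by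
        rw [hz]; field_simp
      have hne : 1 + z ≠ 0 := fun h => by simp [h] at hre
      rw [e, log_ofReal_mul hl (mul_ne_zero hs0 hne), Complex.log_mul hs0 hne, add_assoc]
      have a1 := abs_le.1 (abs_arg_le_pi_div_two_iff.2 hs)
      have a2 := abs_lt.1 (abs_arg_lt_pi_div_two_iff.2 (Or.inl hre))
      constructor <;> linarith [a1.1, a1.2, a2.1, a2.2]
    have hl1 : ‖log (1 + z)‖ ≤ 3 / 2 * ‖z‖ := norm_log_one_add_half_le_self hzn
    have hdiff : ((l * s + m - 1 / 2) * log (l * s + m) - (l * s + m)).re - stirlingMain l m s =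
        ((m - 1 / 2) * Real.log l + (l * s + (m - 1 / 2)) * log (1 + z) - m).re := by
      rw [stirlingMain, ← sub_re, hlog]
      congr 1
      ring
    have hb : ‖(m - 1 / 2) * Real.log l + (l * s + (m - 1 / 2)) * log (1 + z) - m‖ ≤
        ‖m - 1 / 2‖ * |Real.log l| + (l + ‖m - 1 / 2‖) * (3 / 2 * (‖m‖ / l)) + ‖m‖ := by
      refine (norm_sub_le _ _).trans (add_le_add_left ((norm_add_le _ _).trans
        (add_le_add ?_ ?_)) _)
      · rw [norm_mul, norm_real, Real.norm_eq_abs]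
      · rw [add_mul]
        refine (norm_add_le _ _).trans ?_
        rw [norm_mul, norm_mul, norm_mul, norm_real, Real.norm_of_nonneg hl.le, add_mul]
        have h1 : ‖s‖ * ‖log (1 + z)‖ ≤ 3 / 2 * (‖m‖ / l) := by
          calc _ ≤ ‖s‖ * (3 / 2 * ‖z‖) := by gcongr
            _ = _ := by rw [← hsz]; ring
        refine add_le_add ?_ ?_
        · rw [mul_assoc]; gcongr
        · gcongr; linarith
    have h1 := abs_stirlingRemainder_sub_le (hw s hs)
    have h2 := (abs_re_le_norm _).trans hb
    rw [← hdiff] at h2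
    rw [stirlingRemainder] at h1
    rw [norm_one, mul_one, Real.norm_eq_abs]
    have h3 := neg_abs_le (Real.log (√Real.pi) + 1 / 2 * Real.log 2)
    have h4 := le_abs_self (Real.log (√Real.pi) + 1 / 2 * Real.log 2)
    rw [abs_le] at h1 h2 ⊢
    constructor <;> linarith [h1.1, h1.2, h2.1, h2.2]

lemma isBigO_log_norm_affine_sub {l : ℂ} (hl : l ≠ 0) (m : ℂ) (F : Filter ℂ)
    (hF : Tendsto (fun s : ℂ => ‖s‖) F atTop) :
    (∀ᶠ s in F, l * s + m ≠ 0) ∧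
      (fun s : ℂ => Real.log ‖l * s + m‖ - Real.log ‖s‖) =O[F] (fun _ => (1 : ℝ)) := by
  have hinv : Tendsto (fun s : ℂ => s⁻¹) F (𝓝 0) := by
    rw [tendsto_zero_iff_norm_tendsto_zero]
    simp only [norm_inv]
    exact hF.inv_tendsto_atTop
  have h1 : Tendsto (fun s : ℂ => ‖l + m * s⁻¹‖) F (𝓝 ‖l‖) := by
    simpa using ((hinv.const_mul m).const_add l).norm
  have hpos : ∀ᶠ s in F, s ≠ 0 := (hF.eventually_gt_atTop 0).mono fun s hs => norm_pos_iff.1 hs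
  have hne : ∀ᶠ s in F, ‖l + m * s⁻¹‖ ≠ 0 := h1.eventually_ne (norm_ne_zero_iff.2 hl)
  have e : ∀ s : ℂ, s ≠ 0 → l * s + m = (l + m * s⁻¹) * s := fun s hs => by field_simp
  refine ⟨?_, ?_⟩
  · filter_upwards [hpos, hne] with s hs h
    rw [e s hs]
    exact mul_ne_zero (norm_ne_zero_iff.1 h) hs
  · refine ((h1.log (norm_ne_zero_iff.2 hl)).isBigO_one ℝ).congr' ?_ EventuallyEq.rfl
    filter_upwards [hpos, hne] with s hs h
    rw [e s hs, norm_mul, Real.log_mul h (norm_ne_zero_iff.2 hs)]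
    ring

/-- The functional equation costs log |ls+m| = log |s| + O(1), which is also the change of the main
term. -/
lemma HasStirling.of_add_one {l : ℝ} (hl : 0 < l) {m : ℂ} (h : HasStirling l (m + 1)) :
    HasStirling l m := by
  obtain ⟨hne, hO⟩ := isBigO_log_norm_affine_sub (l := l) (by exact_mod_cast hl.ne') m _
    tendsto_norm_rightInfty
  have hG : ∀ᶠ s in rightInfty, Gamma (l * s + (m + 1)) = (l * s + m) * Gamma (l * s + m) := by
    filter_upwards [hne] with s hs
    rw [← add_assoc, Gamma_add_one _ hs]
  have hG0 : ∀ᶠ s in rightInfty, Gamma (l * s + m) ≠ 0 := by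
    filter_upwards [hG, h.1] with s h1 h2 h0
    rw [h1, h0, mul_zero] at h2
    exact h2 rfl
  refine ⟨hG0, (h.2.sub hO).congr' ?_ EventuallyEq.rfl⟩
  filter_upwards [hG, hG0, hne] with s h1 h2 h3
  rw [h1, norm_mul, Real.log_mul (norm_ne_zero_iff.2 h3) (norm_ne_zero_iff.2 h2)]
  have : stirlingMain l (m + 1) s = stirlingMain l m s + Real.log ‖s‖ := by
    rw [stirlingMain, stirlingMain, ← log_re, ← add_re]
    congr 1
    ring
  rw [this]
  ring

lemma hasStirling {l : ℝ} (hl : 0 < l) (m : ℂ) : HasStirling l m := by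
  obtain ⟨N, hN⟩ := exists_nat_ge (2 - m.re)
  have key : ∀ (N : ℕ) (m : ℂ), HasStirling l (m + N) → HasStirling l m := by
    intro N
    induction N with
    | zero => intro m h; simpa using h
    | succ N ih =>
      intro m h
      refine HasStirling.of_add_one hl (ih _ ?_)
      convert h using 1
      push_cast; ring
  exact key N m (hasStirling_of_two_le hl (by simp; linarith))

/-- The exponential growth rate of `γ (s) / Γ (s + p)`. -/
noncomputable def gammaRate {r : ℕ} (Q : ℝ) (l : Fin r → ℝ) : ℝ :=
  Real.log Q + ∑ j, l j * (Real.log (l j) - 1) + 1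

/-- The s log s terms cancel because the `l j` sum to 1. A term linear in Re s and a multiple of log
|s| remain, while Im(∑ m_j)·arg s is bounded. -/
lemma log_norm_gammaFactor_sub_isBigO {r : ℕ} {Q : ℝ} (hQ : 0 < Q) {l : Fin r → ℝ}
    (hl : ∀ j, 0 < l j) (hsum : ∑ j, l j = 1) (m : Fin r → ℂ) (p : ℝ) :
    (∀ᶠ s in rightInfty, gammaFactor Q l m s ≠ 0 ∧ Gamma (s + p) ≠ 0) ∧
    (fun s : ℂ => Real.log ‖gammaFactor Q l m s‖ - Real.log ‖Gamma (s + p)‖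
      - gammaRate Q l * s.re - ((∑ j, m j).re - r / 2 - p + 1 / 2) * Real.log ‖s‖)
      =O[rightInfty] (fun _ => (1 : ℝ)) := by
  have hQC : (Q : ℂ) ≠ 0 := by exact_mod_cast hQ.ne'
  have hp := hasStirling one_pos (p : ℂ)
  have hne : ∀ᶠ s in rightInfty, ∀ j, Gamma (l j * s + m j) ≠ 0 :=
    eventually_all.2 fun j => (hasStirling (hl j) (m j)).1
  have hp1 : ∀ᶠ s in rightInfty, Gamma (s + p) ≠ 0 := by simpa using hp.1
  refine ⟨?_, ?_⟩
  · filter_upwards [hne, hp1] with s h1 h2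
    refine ⟨mul_ne_zero ?_ (Finset.prod_ne_zero_iff.2 fun j _ => h1 j), h2⟩
    simp [cpow_eq_zero_iff, hQC]
  · have hS := IsBigO.sum (A := fun j (s : ℂ) =>
      Real.log ‖Gamma (l j * s + m j)‖ - stirlingMain (l j) (m j) s) (s := Finset.univ)
      fun j _ => (hasStirling (hl j) (m j)).2
    have harg : (fun s : ℂ => (∑ j, m j).im * arg s) =O[rightInfty] (fun _ => (1 : ℝ)) := by
      refine IsBigO.of_bound (|(∑ j, m j).im| * Real.pi) (Eventually.of_forall fun s => ?_)
      rw [norm_one, mul_one, norm_mul, Real.norm_eq_abs, Real.norm_eq_abs]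
      gcongr
      exact abs_arg_le_pi s
    refine ((hS.sub hp.2).sub harg).congr' ?_ EventuallyEq.rfl
    filter_upwards [hne, hp1] with s h1 h2
    have hlogγ : Real.log ‖gammaFactor Q l m s‖ =
        Real.log Q * s.re + ∑ j, Real.log ‖Gamma (l j * s + m j)‖ := by
      rw [gammaFactor, norm_mul, norm_prod, Real.log_mul, Real.log_prod,
        norm_cpow_eq_rpow_re_of_pos hQ, Real.log_rpow hQ, mul_comm]
      · exact fun j _ => norm_ne_zero_iff.2 (h1 j)
      · simp [cpow_eq_zero_iff, hQC]
      · exact Finset.prod_ne_zero_iff.2 fun j _ => norm_ne_zero_iff.2 (h1 j)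
    have hmain : ∑ j, stirlingMain (l j) (m j) s - stirlingMain 1 p s =
        (gammaRate Q l - Real.log Q) * s.re +
          ((∑ j, m j).re - r / 2 - p + 1 / 2) * Real.log ‖s‖ - (∑ j, m j).im * arg s := by
      have e : ∑ j, ((l j : ℂ) * (s * log s) + l j * (Real.log (l j) - 1) * s
          + (m j - 1 / 2) * log s) = s * log s +
          ((∑ j, l j * (Real.log (l j) - 1) : ℝ) : ℂ) * s + (∑ j, m j - r / 2) * log s := by
        rw [Finset.sum_add_distrib, Finset.sum_add_distrib, ← Finset.sum_mul, ← Finset.sum_mul,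
          ← Finset.sum_mul, ← ofReal_sum, hsum]
        push_cast
        rw [Finset.sum_sub_distrib]
        simp only [Finset.sum_const, Finset.card_univ, Fintype.card_fin, nsmul_eq_mul]
        ring
      simp only [stirlingMain]
      rw [← re_sum, e, ← sub_re]
      have e2 : s * log s + ((∑ j, l j * (Real.log (l j) - 1) : ℝ) : ℂ) * s
          + (∑ j, m j - r / 2) * log s -
          ((1 : ℝ) * (s * log s) + (1 : ℝ) * (Real.log 1 - 1) * s + (p - 1 / 2) * log s)
          = ((gammaRate Q l - Real.log Q : ℝ) : ℂ) * s +
            (∑ j, m j + ((- r / 2 - p + 1 / 2 : ℝ) : ℂ)) * log s := by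
        rw [gammaRate]
        push_cast
        simp
        ring
      rw [e2, add_re, re_ofReal_mul, mul_re, log_re, log_im]
      simp only [add_re, ofReal_re, add_im, ofReal_im]
      ring
    rw [Finset.sum_apply, Finset.sum_sub_distrib, hlogγ]
    simp only [ofReal_one, one_mul]
    linarith

end StirlingRatio

/-! ### Shifting vertical contours -/

section Contour

open Complex Filter Topology Asymptotics MeasureTheory

lemma integrable_vertical_of_bound {f : ℂ → ℂ} {σ C : ℝ}
    (hf : ∀ u : ℂ, u.re = σ → DifferentiableAt ℂ f u)
    (hb : ∀ u : ℂ, u.re = σ → ‖f u‖ ≤ C / (1 + u.im ^ 2)) :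
    Integrable fun t : ℝ => f (σ + t * I) := by
  refine (integrable_inv_one_add_sq.const_mul C).mono' ?_ (Eventually.of_forall fun t => ?_)
  · refine Continuous.aestronglyMeasurable (continuous_iff_continuousAt.2 fun t => ?_)
    exact ContinuousAt.comp' (hf _ (by simp)).continuousAt (by fun_prop)
  · simpa [div_eq_mul_inv] using hb (σ + t * I) (by simp)

/-- Vertical contours may be shifted inside a strip in which the integrand is holomorphic and
decays quadratically. -/
lemma integral_vertical_eq_of_bound {f : ℂ → ℂ} {σ₁ σ₂ C : ℝ} (h : σ₁ ≤ σ₂)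
    (hf : ∀ u : ℂ, σ₁ ≤ u.re → u.re ≤ σ₂ → DifferentiableAt ℂ f u)
    (hb : ∀ u : ℂ, σ₁ ≤ u.re → u.re ≤ σ₂ → ‖f u‖ ≤ C / (1 + u.im ^ 2)) :
    ∫ t : ℝ, f (σ₁ + t * I) = ∫ t : ℝ, f (σ₂ + t * I) := by
  have i₁ : Integrable fun t : ℝ => f (σ₁ + t * I) := integrable_vertical_of_bound
    (fun u hu => hf u hu.ge (hu.le.trans h)) (fun u hu => hb u hu.ge (hu.le.trans h))
  have i₂ : Integrable fun t : ℝ => f (σ₂ + t * I) := integrable_vertical_of_bound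
    (fun u hu => hf u (hu ▸ h) hu.le) (fun u hu => hb u (hu ▸ h) hu.le)
  have t₁ := intervalIntegral_tendsto_integral i₁ tendsto_neg_atTop_atBot tendsto_id
  have t₂ := intervalIntegral_tendsto_integral i₂ tendsto_neg_atTop_atBot tendsto_id
  have hhor : ∀ T : ℝ → ℝ, (∀ x, T x ^ 2 = x ^ 2) →
      Tendsto (fun x : ℝ => ∫ y in σ₁..σ₂, f (y + T x * I)) atTop (𝓝 0) := by
    intro T hT
    have hlim : Tendsto (fun x : ℝ => C / (1 + x ^ 2) * |σ₂ - σ₁|) atTop (𝓝 0) := by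
      have : Tendsto (fun x : ℝ => 1 + x ^ 2) atTop atTop :=
        tendsto_atTop_add_const_left _ _ (tendsto_pow_atTop two_ne_zero)
      simpa using (tendsto_const_nhds.div_atTop this).mul_const |σ₂ - σ₁|
    refine squeeze_zero_norm (fun x => ?_) hlim
    refine intervalIntegral.norm_integral_le_of_norm_le_const fun y hy => ?_
    rw [Set.uIoc_of_le h] at hy
    have := hb (y + T x * I) (by simpa using hy.1.le) (by simpa using hy.2)
    simpa [hT] using this
  have hrect : ∀ᶠ T : ℝ in atTop, (∫ y in (-T)..T, f (σ₂ + y * I)) - ∫ y in (-T)..T, f (σ₁ + y * I) =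
      I * ((∫ y in σ₁..σ₂, f (y + (-T : ℝ) * I)) - ∫ y in σ₁..σ₂, f (y + T * I)) := by
    filter_upwards with T
    have hr := integral_boundary_rect_eq_zero_of_differentiableOn f (σ₁ + (-T : ℝ) * I)
      (σ₂ + T * I) (fun u hu => by
        rw [mem_reProdIm] at hu
        simp only [add_re, ofReal_re, mul_re, I_re, mul_zero, ofReal_im, I_im,
          add_zero, mul_one, sub_self] at hu
        rw [Set.uIcc_of_le h] at hu
        exact (hf u hu.1.1 hu.1.2).differentiableWithinAt)
    simp only [add_re, ofReal_re, mul_re, I_re, mul_zero, ofReal_im, I_im,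
      add_zero, mul_one, sub_self, add_im, mul_im, zero_add, smul_eq_mul] at hr
    linear_combination (-I) * hr + ((∫ y in (-T)..T, f (σ₂ + y * I)) -
      ∫ y in (-T)..T, f (σ₁ + y * I)) * (I_sq)
  have h0 : Tendsto (fun T : ℝ => (∫ y in (-T)..T, f (σ₂ + y * I)) -
      ∫ y in (-T)..T, f (σ₁ + y * I)) atTop (𝓝 (I * (0 - 0))) := by
    refine (((hhor (fun x => -x) (by simp)).sub (hhor id (by simp))).const_mul I).congr' ?_
    filter_upwards [hrect] with T hT using hT.symm
  have := tendsto_nhds_unique h0 (t₂.sub t₁)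
  simp only [sub_self, mul_zero] at this
  exact (sub_eq_zero.1 this.symm).symm

end Contour

/-! ### Holomorphy and decay of the kernel -/

section Kernel

open Complex Filter Topology Asymptotics MeasureTheory

/-- The integrand of the Mellin–Barnes integral at `s = x = 1`, with `a = (lam - 1) / 2`. -/
noncomputable def barnesKernel (γ : ℂ → ℂ) (a : ℝ) (u : ℂ) : ℂ :=
  Gammaℂ (u + a) * γ (-u) * (Gammaℂ (a + 1 - u))⁻¹ * (γ (1 + u))⁻¹

lemma mellinBarnesIntegrand_one_one (γ : ℂ → ℂ) (lam : ℝ) (u : ℂ) :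
    mellinBarnesIntegrand γ lam 1 1 u = barnesKernel γ ((lam - 1) / 2) u := by
  rw [mellinBarnesIntegrand, barnesKernel, ofReal_one, one_cpow, mul_one, div_eq_mul_inv, mul_inv]
  have e1 : (1 - 1 - u : ℂ) = -u := by ring
  have e2 : -u + ((lam : ℂ) + 1) / 2 = (((lam - 1) / 2 : ℝ) : ℂ) + 1 - u := by push_cast; ring
  have e3 : u + ((lam : ℂ) - 1) / 2 = u + (((lam - 1) / 2 : ℝ) : ℂ) := by push_cast; ring
  rw [e1, e2, e3]
  ring

variable {r : ℕ} {Q : ℝ} {l : Fin r → ℝ} {m : Fin r → ℂ}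

lemma cpow_ofReal_ne_zero (hQ : 0 < Q) (s : ℂ) : (Q : ℂ) ^ s ≠ 0 := by
  have : (Q : ℂ) ≠ 0 := by exact_mod_cast hQ.ne'
  simp [cpow_eq_zero_iff, this]

lemma gammaFactor_inv (s : ℂ) : (gammaFactor Q l m s)⁻¹ =
    ((Q : ℂ) ^ s)⁻¹ * ∏ j, (Gamma (l j * s + m j))⁻¹ := by
  rw [gammaFactor, mul_inv, Finset.prod_inv_distrib]

lemma differentiable_cpow_ofReal (hQ : 0 < Q) : Differentiable ℂ fun s : ℂ => (Q : ℂ) ^ s :=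
  fun s => (differentiableAt_id).const_cpow (Or.inl (by exact_mod_cast hQ.ne'))

lemma differentiable_gammaFactor_inv (hQ : 0 < Q) :
    Differentiable ℂ fun s => (gammaFactor Q l m s)⁻¹ := by
  simp only [gammaFactor_inv]
  refine ((differentiable_cpow_ofReal hQ).inv (cpow_ofReal_ne_zero hQ)).mul ?_
  refine Differentiable.fun_finsetProd fun j _ => ?_
  exact differentiable_one_div_Gamma.comp (by fun_prop)

lemma re_affine_pos (hl : ∀ j, 0 < l j) (hm : ∀ j, -(1 / 2 : ℝ) * l j < (m j).re) {s : ℂ}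
    (hs : 1 / 2 ≤ s.re) (j : Fin r) : 0 < (l j * s + m j).re := by
  rw [add_re, re_ofReal_mul]
  nlinarith [hl j, hm j]

lemma gammaFactor_ne_zero (hQ : 0 < Q) (hl : ∀ j, 0 < l j)
    (hm : ∀ j, -(1 / 2 : ℝ) * l j < (m j).re) {s : ℂ} (hs : 1 / 2 ≤ s.re) :
    gammaFactor Q l m s ≠ 0 :=
  mul_ne_zero (cpow_ofReal_ne_zero hQ s) (Finset.prod_ne_zero_iff.2 fun j _ =>
    Gamma_ne_zero_of_re_pos (re_affine_pos hl hm hs j))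

lemma differentiableAt_gammaFactor (hQ : 0 < Q) (hl : ∀ j, 0 < l j)
    (hm : ∀ j, -(1 / 2 : ℝ) * l j < (m j).re) {s : ℂ} (hs : 1 / 2 ≤ s.re) :
    DifferentiableAt ℂ (gammaFactor Q l m) s := by
  have h := (differentiable_gammaFactor_inv (l := l) (m := m) hQ s).fun_inv
    (inv_ne_zero (gammaFactor_ne_zero hQ hl hm hs))
  simpa using h

lemma Gammaℂ_ne_zero_of_re_pos {s : ℂ} (hs : 0 < s.re) : Gammaℂ s ≠ 0 := by
  rw [Gammaℂ_def]
  have h2 : (2 * (Real.pi : ℂ)) ^ (-s) ≠ 0 := by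
    exact_mod_cast cpow_ofReal_ne_zero (Q := 2 * Real.pi) (by positivity) (-s)
  exact mul_ne_zero (mul_ne_zero two_ne_zero h2) (Gamma_ne_zero_of_re_pos hs)

lemma differentiableAt_Gammaℂ {s : ℂ} (hs : 0 < s.re) : DifferentiableAt ℂ Gammaℂ s := by
  have h := (differentiable_Gammaℂ_inv s).fun_inv (inv_ne_zero (Gammaℂ_ne_zero_of_re_pos hs))
  simpa using h

lemma differentiableAt_barnesKernel (hQ : 0 < Q) (hl : ∀ j, 0 < l j)
    (hm : ∀ j, -(1 / 2 : ℝ) * l j < (m j).re) {a : ℝ} {u : ℂ} (h1 : -a < u.re)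
    (h2 : u.re ≤ -1 / 2) : DifferentiableAt ℂ (barnesKernel (gammaFactor Q l m) a) u := by
  unfold barnesKernel
  have d1 : DifferentiableAt ℂ (fun u : ℂ => Gammaℂ (u + a)) u :=
    DifferentiableAt.comp (g := Gammaℂ) u
      (differentiableAt_Gammaℂ (by simp; linarith)) (by fun_prop)
  have d2 : DifferentiableAt ℂ (fun u : ℂ => gammaFactor Q l m (-u)) u :=
    DifferentiableAt.comp (g := gammaFactor Q l m) u
      (differentiableAt_gammaFactor hQ hl hm (by simp; linarith)) (by fun_prop)
  have d3 : DifferentiableAt ℂ (fun u : ℂ => (Gammaℂ (a + 1 - u))⁻¹) u :=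
    DifferentiableAt.comp (g := fun s => (Gammaℂ s)⁻¹) u
      (differentiable_Gammaℂ_inv _) (by fun_prop)
  have d4 : DifferentiableAt ℂ (fun u : ℂ => (gammaFactor Q l m (1 + u))⁻¹) u :=
    DifferentiableAt.comp (g := fun s => (gammaFactor Q l m s)⁻¹) u
      (differentiable_gammaFactor_inv hQ _) (by fun_prop)
  exact ((d1.mul d2).mul d3).mul d4

lemma gammaFactor_add_const (hQ : 0 < Q) (s b : ℂ) : gammaFactor Q l m (s + b) =
    (Q : ℂ) ^ b * gammaFactor Q l (fun j => m j + l j * b) s := by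
  have hQC : (Q : ℂ) ≠ 0 := by exact_mod_cast hQ.ne'
  rw [gammaFactor, gammaFactor, cpow_add _ _ hQC]
  have : ∀ j, (l j : ℂ) * (s + b) + m j = l j * s + (m j + l j * b) := fun j => by ring
  simp only [this]
  ring

/-- The filter of points of a vertical strip with large imaginary part. -/
noncomputable def stripInfty (σ₁ σ₂ : ℝ) : Filter ℂ :=
  comap (fun u : ℂ => |u.im|) atTop ⊓ 𝓟 {u | σ₁ ≤ u.re ∧ u.re ≤ σ₂}

lemma eventually_stripInfty_re (σ₁ σ₂ : ℝ) :
    ∀ᶠ u in stripInfty σ₁ σ₂, σ₁ ≤ u.re ∧ u.re ≤ σ₂ :=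
  mem_inf_of_right (mem_principal_self _)

lemma tendsto_abs_im_stripInfty (σ₁ σ₂ : ℝ) :
    Tendsto (fun u : ℂ => |u.im|) (stripInfty σ₁ σ₂) atTop :=
  tendsto_comap.mono_left inf_le_left

lemma tendsto_affine_stripInfty_rightInfty {σ₁ σ₂ ε b : ℝ} (hε : |ε| = 1)
    (h : ∀ x, σ₁ ≤ x → x ≤ σ₂ → 0 ≤ ε * x + b) :
    Tendsto (fun u : ℂ => ε * u + b) (stripInfty σ₁ σ₂) rightInfty := by
  refine tendsto_inf.2 ⟨?_, tendsto_principal.2 ?_⟩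
  · rw [← tendsto_norm_atTop_iff_cobounded]
    refine tendsto_atTop_mono (fun u => ?_) (tendsto_abs_im_stripInfty σ₁ σ₂)
    refine le_trans (le_of_eq ?_) (abs_im_le_norm _)
    simp [abs_mul, hε]
  · filter_upwards [eventually_stripInfty_re σ₁ σ₂] with u hu
    simpa using h _ hu.1 hu.2

/-- In a strip, Γ_ℂ(u+a)/Γ_ℂ(a+1-u) has size |u|^(2 Re u - 1) and γ(-u)/γ(1+u) has size |u|^(-2 Re u
- 1) up to bounded factors. To obtain this from ratios, γ(-u) is compared with Γ(-u+a+1) and γ(1+u)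
with Γ(u+a). -/
lemma isBigO_log_barnesKernel (hQ : 0 < Q) (hl : ∀ j, 0 < l j) (hsum : ∑ j, l j = 1)
    (m : Fin r → ℂ) {a σ₁ σ₂ : ℝ} (h1 : -a < σ₁) (h2 : σ₂ ≤ 0) :
    (∀ᶠ u in stripInfty σ₁ σ₂, barnesKernel (gammaFactor Q l m) a u ≠ 0) ∧
    (fun u : ℂ => Real.log ‖barnesKernel (gammaFactor Q l m) a u‖ + 2 * Real.log ‖u‖)
      =O[stripInfty σ₁ σ₂] (fun _ => (1 : ℝ)) := by
  -- Rewrites γ(1+u) as a gamma factor in the variable u+a, which stays in the right half-plane on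
  -- the strip; u itself need not.
  set m' : Fin r → ℂ := fun j => m j + l j * ((1 - a : ℝ) : ℂ) with hm'
  have hsm : (∑ j, m' j).re = (∑ j, m j).re + (1 - a) := by
    rw [hm', Finset.sum_add_distrib, ← Finset.sum_mul, ← ofReal_sum, hsum]
    simp
  have t1 := tendsto_affine_stripInfty_rightInfty (σ₁ := σ₁) (σ₂ := σ₂) (ε := -1) (b := 0)
    (by simp) (fun x _ hx => by linarith)
  have t2 := tendsto_affine_stripInfty_rightInfty (σ₁ := σ₁) (σ₂ := σ₂) (ε := 1) (b := a)
    (by simp) (fun x hx _ => by linarith)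
  have A := log_norm_gammaFactor_sub_isBigO hQ hl hsum m (a + 1)
  have B := log_norm_gammaFactor_sub_isBigO hQ hl hsum m' 0
  have A1 := t1.eventually A.1
  have B1 := t2.eventually B.1
  have A2 := A.2.comp_tendsto t1
  have B2 := B.2.comp_tendsto t2
  have hnorm : Tendsto (fun u : ℂ => ‖u‖) (stripInfty σ₁ σ₂) atTop :=
    tendsto_atTop_mono (fun u => abs_im_le_norm u) (tendsto_abs_im_stripInfty σ₁ σ₂)
  have C2 := (isBigO_log_norm_affine_sub (l := 1) one_ne_zero (a : ℂ) _ hnorm).2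
  simp only [ofReal_neg, ofReal_one, ofReal_zero, add_zero, neg_mul, one_mul] at A1 B1 A2 B2 C2
  have hbase : ∀ u : ℂ, barnesKernel (gammaFactor Q l m) a u =
      ((2 * Real.pi : ℝ) : ℂ) ^ (1 - 2 * u) * Gamma (u + a) * gammaFactor Q l m (-u) *
        (Gamma (-u + (a + 1 : ℝ)))⁻¹ *
        ((Q : ℂ) ^ ((1 - a : ℝ) : ℂ) * gammaFactor Q l m' (u + a))⁻¹ := by
    intro u
    have e1 : (1 + u : ℂ) = (u + a) + ((1 - a : ℝ) : ℂ) := by push_cast; ring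
    rw [barnesKernel, e1, gammaFactor_add_const hQ, Gammaℂ_def, Gammaℂ_def]
    have e2 : (a : ℂ) + 1 - u = -u + (a + 1 : ℝ) := by push_cast; ring
    have hpi : (2 * (Real.pi : ℂ)) ≠ 0 := by simp
    have e3 : ((2 * Real.pi : ℝ) : ℂ) ^ (1 - 2 * u) =
        (2 * (Real.pi : ℂ)) ^ (-(u + a)) * ((2 * (Real.pi : ℂ)) ^ (-(-u + (a + 1 : ℝ)) : ℂ))⁻¹ := by
      rw [← cpow_neg, ← cpow_add _ _ hpi]
      push_cast
      congr 1
      ring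
    rw [e2, e3]
    simp only [mul_inv]
    ring
  have hne : ∀ u : ℂ, gammaFactor Q l m (-u) ≠ 0 ∧ Gamma (-u + (a + 1 : ℝ)) ≠ 0 →
      gammaFactor Q l m' (u + a) ≠ 0 ∧ Gamma (u + a) ≠ 0 →
      barnesKernel (gammaFactor Q l m) a u ≠ 0 := by
    intro u ha hb
    rw [hbase]
    exact mul_ne_zero (mul_ne_zero (mul_ne_zero (mul_ne_zero
      (cpow_ofReal_ne_zero (by positivity) _) hb.2) ha.1) (inv_ne_zero ha.2))
      (inv_ne_zero (mul_ne_zero (cpow_ofReal_ne_zero hQ _) hb.1))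
  refine ⟨?_, ?_⟩
  · filter_upwards [A1, B1] with u ha hb using hne u ha hb
  · have hre : (fun u : ℂ => Real.log (2 * Real.pi) * (1 - 2 * u.re) - Real.log Q * (1 - a)
        - gammaRate Q l * (2 * u.re + a)) =O[stripInfty σ₁ σ₂] (fun _ => (1 : ℝ)) := by
      have hu : (fun u : ℂ => u.re) =O[stripInfty σ₁ σ₂] (fun _ => (1 : ℝ)) := by
        refine IsBigO.of_bound (|σ₁| + |σ₂|) ?_
        filter_upwards [eventually_stripInfty_re σ₁ σ₂] with u hu
        rw [norm_one, mul_one, Real.norm_eq_abs, abs_le]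
        constructor
        · linarith [neg_abs_le σ₁, abs_nonneg σ₂]
        · linarith [le_abs_self σ₂, abs_nonneg σ₁]
      have hc : ∀ c : ℝ, (fun _ : ℂ => c) =O[stripInfty σ₁ σ₂] (fun _ => (1 : ℝ)) :=
        fun c => isBigO_const_const c one_ne_zero _
      refine (((hu.const_mul_left (-2 * Real.log (2 * Real.pi) - 2 * gammaRate Q l)).add
        (hc (Real.log (2 * Real.pi) - Real.log Q * (1 - a) - gammaRate Q l * a)))).congr_left ?_
      intro u; ring
    refine (((A2.sub B2).add hre).sub (C2.const_mul_left
      ((∑ j, m j).re + (1 - a) - r / 2 + 1 / 2))).congr' ?_ EventuallyEq.rfl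
    filter_upwards [A1, B1] with u ha hb
    have hpi : (0 : ℝ) < 2 * Real.pi := by positivity
    have hlogK : Real.log ‖barnesKernel (gammaFactor Q l m) a u‖ =
        (1 - 2 * u.re) * Real.log (2 * Real.pi) + Real.log ‖Gamma (u + a)‖ +
          Real.log ‖gammaFactor Q l m (-u)‖ - Real.log ‖Gamma (-u + (a + 1 : ℝ))‖ -
          ((1 - a) * Real.log Q + Real.log ‖gammaFactor Q l m' (u + a)‖) := by
      rw [hbase, norm_mul, norm_mul, norm_mul, norm_mul, norm_inv, norm_inv, norm_mul,
        Real.log_mul, Real.log_mul, Real.log_mul, Real.log_mul, Real.log_inv, Real.log_inv,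
        Real.log_mul, norm_cpow_eq_rpow_re_of_pos hpi, norm_cpow_eq_rpow_re_of_pos hQ,
        Real.log_rpow hpi, Real.log_rpow hQ]
      · simp only [sub_re, one_re, mul_re, re_ofNat, im_ofNat, zero_mul, sub_zero, ofReal_re]
        ring
      all_goals
        simp only [ne_eq, mul_eq_zero, inv_eq_zero, norm_eq_zero, ha.1, ha.2, hb.1, hb.2,
          cpow_ofReal_ne_zero hpi, cpow_ofReal_ne_zero hQ, or_self, not_false_eq_true]
    rw [hlogK]
    simp only [Function.comp_apply, norm_neg, neg_re, add_re, ofReal_re, hsm]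
    ring

/-- Stirling covers large |Im u|, compactness the rest of the strip. -/
lemma barnesKernel_bound (hQ : 0 < Q) (hl : ∀ j, 0 < l j) (hsum : ∑ j, l j = 1)
    (hm : ∀ j, -(1 / 2 : ℝ) * l j < (m j).re) {a σ₁ σ₂ : ℝ} (h1 : -a < σ₁) (h2 : σ₂ ≤ -1 / 2) :
    ∃ C, 0 ≤ C ∧ ∀ u : ℂ, σ₁ ≤ u.re → u.re ≤ σ₂ →
      ‖barnesKernel (gammaFactor Q l m) a u‖ ≤ C / (1 + u.im ^ 2) := by
  obtain ⟨hne, hO⟩ := isBigO_log_barnesKernel hQ hl hsum m h1 (by linarith : σ₂ ≤ 0)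
  obtain ⟨c, hc⟩ := hO.bound
  have hev := (hne.and hc)
  rw [stripInfty, eventually_inf_principal, eventually_comap] at hev
  obtain ⟨T, hT⟩ := eventually_atTop.1 hev
  set T' := max T 1 with hT'
  have hcpt : IsCompact (Set.Icc σ₁ σ₂ ×ℂ Set.Icc (-T') T') := isCompact_Icc.reProdIm isCompact_Icc
  have hcont : ContinuousOn (barnesKernel (gammaFactor Q l m) a)
      (Set.Icc σ₁ σ₂ ×ℂ Set.Icc (-T') T') := fun u hu => by
    rw [mem_reProdIm] at hu
    exact (differentiableAt_barnesKernel hQ hl hm (by linarith [hu.1.1])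
      (by linarith [hu.1.2])).continuousAt.continuousWithinAt
  obtain ⟨M, hM⟩ := hcpt.exists_bound_of_continuousOn hcont
  refine ⟨max (|M| * (1 + T' ^ 2)) (2 * Real.exp c), le_max_of_le_right (by positivity),
    fun u hu1 hu2 => ?_⟩
  have hpos : 0 < 1 + u.im ^ 2 := by positivity
  rw [le_div_iff₀ hpos]
  rcases le_total |u.im| T' with h | h
  · refine le_max_of_le_left ?_
    have hMu := (hM u (by
      rw [mem_reProdIm]; exact ⟨⟨hu1, hu2⟩, abs_le.1 h⟩)).trans (le_abs_self M)
    have : u.im ^ 2 ≤ T' ^ 2 := by rw [← sq_abs]; gcongr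
    gcongr
  · refine le_max_of_le_right ?_
    obtain ⟨hn, hb⟩ := hT |u.im| ((le_max_left _ _).trans h) u rfl ⟨hu1, hu2⟩
    have him : 1 ≤ |u.im| := (le_max_right _ _).trans h
    have hun : |u.im| ≤ ‖u‖ := abs_im_le_norm u
    have hu0 : 0 < ‖u‖ := by linarith
    rw [norm_one, mul_one, Real.norm_eq_abs] at hb
    have hb' := (le_abs_self _).trans hb
    have hlog : Real.log (‖barnesKernel (gammaFactor Q l m) a u‖ * ‖u‖ ^ 2) ≤ c := by
      rw [Real.log_mul (norm_ne_zero_iff.2 hn) (by positivity), Real.log_pow]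
      exact_mod_cast hb'
    rw [Real.log_le_iff_le_exp (by positivity)] at hlog
    have h3 : 1 + u.im ^ 2 ≤ 2 * ‖u‖ ^ 2 := by
      have : u.im ^ 2 ≤ ‖u‖ ^ 2 := by rw [← sq_abs]; gcongr
      nlinarith
    calc _ ≤ ‖barnesKernel (gammaFactor Q l m) a u‖ * (2 * ‖u‖ ^ 2) := by gcongr
      _ ≤ 2 * Real.exp c := by linarith

end Kernel

/-! ### Orthogonality to rational functions -/

section RationalFunctions

open Complex MeasureTheory Polynomial

variable {a σ : ℝ}

lemma one_le_norm_sub_vertical (hσ : σ ≤ a) (i : ℕ) (t : ℝ) :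
    1 ≤ ‖(a + 1 + i - (σ + t * I) : ℂ)‖ := by
  refine le_trans ?_ (re_le_norm _)
  simp
  linarith [(Nat.cast_nonneg i : (0 : ℝ) ≤ i)]

lemma sub_vertical_ne_zero (hσ : σ ≤ a) (i : ℕ) (t : ℝ) :
    (a + 1 + i - (σ + t * I) : ℂ) ≠ 0 :=
  norm_pos_iff.1 (by linarith [one_le_norm_sub_vertical hσ i t])

lemma polynomial_eval_eq_mul_add (p : ℂ[X]) (z w : ℂ) :
    p.eval w = (w - z) * (p /ₘ (X - C z)).eval w + p.eval z := by
  have h := congrArg (eval w) (modByMonic_add_div p (X - C z))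
  rw [modByMonic_X_sub_C_eq_C_eval] at h
  simp at h
  rw [← h]; ring

lemma natDegree_divByMonic_X_sub_C_le {p : ℂ[X]} {N : ℕ} (hp : p.natDegree ≤ N + 1) (z : ℂ) :
    (p /ₘ (X - C z)).natDegree ≤ N := by
  rw [natDegree_divByMonic _ (monic_X_sub_C z), natDegree_X_sub_C]
  omega

/-- Division of `p` by the last linear factor leaves a quotient with one factor fewer and a constant
over a product of factors of norm at least 1. -/
lemma exists_bound_eval_div_prod (hσ : σ ≤ a) (N : ℕ) (p : ℂ[X]) (hp : p.natDegree ≤ N) :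
    ∃ B, ∀ t : ℝ, ‖p.eval (σ + t * I : ℂ) /
      ∏ i ∈ Finset.range N, (a + 1 + i - (σ + t * I) : ℂ)‖ ≤ B := by
  induction N generalizing p with
  | zero =>
    rw [eq_C_of_natDegree_le_zero hp]
    exact ⟨‖p.coeff 0‖, fun t => by simp⟩
  | succ N ih =>
    obtain ⟨B, hB⟩ := ih _ (natDegree_divByMonic_X_sub_C_le hp (a + 1 + N))
    refine ⟨B + ‖p.eval (a + 1 + N : ℂ)‖, fun t => ?_⟩
    have hN := sub_vertical_ne_zero hσ N t
    have hprod : ∏ i ∈ Finset.range N, (a + 1 + i - (σ + t * I) : ℂ) ≠ 0 :=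
      Finset.prod_ne_zero_iff.2 fun i _ => sub_vertical_ne_zero hσ i t
    have e : p.eval (σ + t * I : ℂ) /
        ∏ i ∈ Finset.range (N + 1), (a + 1 + i - (σ + t * I) : ℂ) =
        -((p /ₘ (X - C (a + 1 + N : ℂ))).eval (σ + t * I : ℂ) /
          ∏ i ∈ Finset.range N, (a + 1 + i - (σ + t * I) : ℂ)) + p.eval (a + 1 + N : ℂ) /
        ∏ i ∈ Finset.range (N + 1), (a + 1 + i - (σ + t * I) : ℂ) := by
      rw [polynomial_eval_eq_mul_add p (a + 1 + N) (σ + t * I), Finset.prod_range_succ]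
      field_simp
      ring
    rw [e]
    refine (norm_add_le _ _).trans (add_le_add (by rw [norm_neg]; exact hB t) ?_)
    rw [norm_div, norm_prod]
    exact div_le_self (norm_nonneg _)
      (Finset.one_le_prod fun i _ => one_le_norm_sub_vertical hσ i t)

lemma continuous_eval_div_prod (hσ : σ ≤ a) (N : ℕ) (p : ℂ[X]) :
    Continuous fun t : ℝ => p.eval (σ + t * I : ℂ) /
      ∏ i ∈ Finset.range N, (a + 1 + i - (σ + t * I) : ℂ) := by
  refine Continuous.div ?_ (by fun_prop)
    (fun t => Finset.prod_ne_zero_iff.2 fun i _ => sub_vertical_ne_zero hσ i t)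
  exact p.continuous.comp (by fun_prop)

lemma integrable_mul_eval_div_prod (hσ : σ ≤ a) {K : ℝ → ℂ} (hK : Integrable K) {N : ℕ}
    {p : ℂ[X]} (hp : p.natDegree ≤ N) :
    Integrable fun t : ℝ => K t * (p.eval (σ + t * I : ℂ) /
      ∏ i ∈ Finset.range N, (a + 1 + i - (σ + t * I) : ℂ)) := by
  obtain ⟨B, hB⟩ := exists_bound_eval_div_prod hσ N p hp
  exact hK.mul_bdd (continuous_eval_div_prod hσ N p).aestronglyMeasurable
    (Filter.Eventually.of_forall hB)

/-- If `K` is orthogonal to `(u + a)_k / (a + 1 - u)_k` for all `k`, then it is orthogonal to all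
rational functions with simple poles in `a + 1, a + 2, …` that are bounded at infinity. -/
lemma integral_mul_eval_div_prod_eq_zero (hσ : σ ≤ a) (ha : 0 < a) {K : ℝ → ℂ}
    (hK : Integrable K)
    (h : ∀ k : ℕ, ∫ t : ℝ, K t * ((∏ i ∈ Finset.range k, (σ + t * I + a + i : ℂ)) /
      ∏ i ∈ Finset.range k, (a + 1 + i - (σ + t * I) : ℂ)) = 0)
    (N : ℕ) (p : ℂ[X]) (hp : p.natDegree ≤ N) :
    ∫ t : ℝ, K t * (p.eval (σ + t * I : ℂ) /
      ∏ i ∈ Finset.range N, (a + 1 + i - (σ + t * I) : ℂ)) = 0 := by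
  induction N generalizing p with
  | zero =>
    rw [eq_C_of_natDegree_le_zero hp]
    have := h 0
    simp only [Finset.range_zero, Finset.prod_empty, div_one, mul_one, eval_C] at this ⊢
    rw [integral_mul_const, this, zero_mul]
  | succ N ih =>
    set z : ℂ := a + 1 + N with hz
    set P : ℂ[X] := ∏ i ∈ Finset.range (N + 1), (X + C (a + i : ℂ)) with hP
    have hPeval : ∀ w : ℂ, P.eval w = ∏ i ∈ Finset.range (N + 1), (w + a + i) := fun w => by
      rw [hP, eval_prod]
      simp [add_assoc]
    have hPz : P.eval z ≠ 0 := by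
      rw [hPeval, Finset.prod_ne_zero_iff]
      intro i _ h0
      have := congrArg re h0
      simp [hz] at this
      have h1 : (0 : ℝ) ≤ N := N.cast_nonneg
      have h2 : (0 : ℝ) ≤ i := i.cast_nonneg
      linarith
    have hPdeg : P.natDegree ≤ N + 1 := by
      rw [hP]
      refine (natDegree_prod_le _ _).trans ?_
      simp only [natDegree_X_add_C, Finset.sum_const, Finset.card_range, smul_eq_mul, mul_one,
        le_refl]
    -- Subtracting this multiple of the given numerator (u+a)_(N+1) makes the difference vanish at z
    -- = a+1+N, so the last pole cancels and induction applies.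
    set c : ℂ := p.eval z / P.eval z with hc
    set q := (p - C c * P) /ₘ (X - C z) with hq
    have hdeg : (p - C c * P).natDegree ≤ N + 1 :=
      (natDegree_sub_le _ _).trans (max_le hp ((natDegree_C_mul_le _ _).trans hPdeg))
    have hqdeg : q.natDegree ≤ N := natDegree_divByMonic_X_sub_C_le hdeg z
    have hpw : ∀ w, p.eval w = c * P.eval w + (w - z) * q.eval w := fun w => by
      have h1 := polynomial_eval_eq_mul_add (p - C c * P) z w
      have h2 : (p - C c * P).eval z = 0 := by
        simp [hc, hPz]
      rw [h2] at h1
      simp only [eval_sub, eval_mul, eval_C] at h1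
      linear_combination h1
    have e : ∀ t : ℝ, K t * (p.eval (σ + t * I : ℂ) /
        ∏ i ∈ Finset.range (N + 1), (a + 1 + i - (σ + t * I) : ℂ)) =
        c * (K t * (P.eval (σ + t * I : ℂ) /
          ∏ i ∈ Finset.range (N + 1), (a + 1 + i - (σ + t * I) : ℂ))) -
        K t * (q.eval (σ + t * I : ℂ) /
          ∏ i ∈ Finset.range N, (a + 1 + i - (σ + t * I) : ℂ)) := fun t => by
      have hN := sub_vertical_ne_zero hσ N t
      have hprod : ∏ i ∈ Finset.range N, (a + 1 + i - (σ + t * I) : ℂ) ≠ 0 :=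
        Finset.prod_ne_zero_iff.2 fun i _ => sub_vertical_ne_zero hσ i t
      rw [hpw, Finset.prod_range_succ, hz]
      field_simp
      ring
    simp only [e]
    rw [integral_sub ((integrable_mul_eval_div_prod hσ hK hPdeg).const_mul c)
      (integrable_mul_eval_div_prod hσ hK hqdeg), ih q hqdeg, integral_const_mul]
    simp only [hPeval]
    rw [h (N + 1), mul_zero, sub_zero]

/-- The numerator is taken to be the product of the first `n` factors of the denominator, so that a
single pole survives. -/
lemma integral_mul_inv_sub_eq_zero (hσ : σ ≤ a) (ha : 0 < a) {K : ℝ → ℂ}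
    (hK : Integrable K)
    (h : ∀ k : ℕ, ∫ t : ℝ, K t * ((∏ i ∈ Finset.range k, (σ + t * I + a + i : ℂ)) /
      ∏ i ∈ Finset.range k, (a + 1 + i - (σ + t * I) : ℂ)) = 0) (n : ℕ) :
    ∫ t : ℝ, K t * (a + 1 + n - (σ + t * I) : ℂ)⁻¹ = 0 := by
  set p : ℂ[X] := ∏ i ∈ Finset.range n, (C (a + 1 + i : ℂ) - X) with hp
  have hdeg : p.natDegree ≤ n + 1 := by
    refine (natDegree_prod_le _ _).trans ?_
    refine (Finset.sum_le_card_nsmul _ _ 1 fun i _ => ?_).trans (by simp)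
    exact (natDegree_sub_le _ _).trans (by rw [natDegree_C, natDegree_X]; simp)
  rw [← integral_mul_eval_div_prod_eq_zero hσ ha hK h (n + 1) p hdeg]
  refine integral_congr_ae (Filter.Eventually.of_forall fun t => ?_)
  have hN := sub_vertical_ne_zero hσ n t
  have hprod : ∏ i ∈ Finset.range n, (a + 1 + i - (σ + t * I) : ℂ) ≠ 0 :=
    Finset.prod_ne_zero_iff.2 fun i _ => sub_vertical_ne_zero hσ i t
  simp only [hp, eval_prod, eval_sub, eval_C, eval_X, Finset.prod_range_succ]
  field_simp

end RationalFunctions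

/-! ### Vanishing moments -/

section Moments

open Complex MeasureTheory Set

lemma eq_zero_of_real_moments_eq_zero {f : ℝ → ℝ} (hf : ContinuousOn f (Icc 0 1))
    (h : ∀ n : ℕ, ∫ x in (0 : ℝ)..1, x ^ n * f x = 0) : ∀ x ∈ Icc (0 : ℝ) 1, f x = 0 := by
  have hu : uIcc (0 : ℝ) 1 = Icc 0 1 := uIcc_of_le zero_le_one
  have hpoly : ∀ p : Polynomial ℝ, ∫ x in (0 : ℝ)..1, p.eval x * f x = 0 := by
    intro p
    simp only [Polynomial.eval_eq_sum_range, Finset.sum_mul]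
    rw [intervalIntegral.integral_finsetSum]
    · refine Finset.sum_eq_zero fun i _ => ?_
      simp only [mul_assoc]
      rw [intervalIntegral.integral_const_mul, h, mul_zero]
    · intro i _
      refine ContinuousOn.intervalIntegrable ?_
      rw [hu]
      exact ContinuousOn.mul (by fun_prop) hf
  obtain ⟨M, hM⟩ := isCompact_Icc.exists_bound_of_continuousOn hf
  have hM0 : 0 ≤ M := (norm_nonneg _).trans (hM 0 (by simp))
  have hsq : ∫ x in (0 : ℝ)..1, f x * f x ≤ 0 := by
    -- By Weierstrass, one factor `f` may be replaced by `f - p` with `p` a polynomial uniformly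
    -- close to `f`, as `p` is orthogonal to `f`.
    refine le_of_forall_pos_le_add fun ε hε => ?_
    obtain ⟨p, hp⟩ := exists_polynomial_near_of_continuousOn 0 1 f hf (ε / (M + 1)) (by positivity)
    have e : ∫ x in (0 : ℝ)..1, f x * f x = ∫ x in (0 : ℝ)..1, (f x - p.eval x) * f x := by
      simp only [sub_mul]
      rw [intervalIntegral.integral_sub, hpoly, sub_zero]
      · exact ContinuousOn.intervalIntegrable (by rw [hu]; exact hf.mul hf)
      · exact ContinuousOn.intervalIntegrable (by rw [hu]; exact p.continuous.continuousOn.mul hf)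
    rw [e, zero_add]
    refine (le_abs_self _).trans ?_
    have := intervalIntegral.norm_integral_le_of_norm_le_const (a := (0 : ℝ)) (b := 1) (C := ε)
      (f := fun x => (f x - p.eval x) * f x) (fun x hx => by
        rw [uIoc_of_le zero_le_one] at hx
        have hx' : x ∈ Icc (0 : ℝ) 1 := ⟨hx.1.le, hx.2⟩
        rw [norm_mul]
        have h1 := (hp x hx').le
        have h2 := hM x hx'
        rw [abs_sub_comm] at h1
        calc ‖f x - p.eval x‖ * ‖f x‖ ≤ ε / (M + 1) * M := by
              gcongr
              exact h1
          _ ≤ ε := by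
              rw [div_mul_eq_mul_div, div_le_iff₀ (by positivity)]
              nlinarith)
    simpa using this
  intro x hx
  by_contra hne
  have : 0 < ∫ x in (0 : ℝ)..1, f x * f x :=
    intervalIntegral.integral_pos one_pos (hf.mul hf) (fun y _ => mul_self_nonneg _)
      ⟨x, hx, mul_self_pos.2 hne⟩
  linarith

/-- A continuous function on `[0, 1]` all of whose moments vanish is zero. -/
lemma eq_zero_of_moments_eq_zero {f : ℝ → ℂ} (hf : ContinuousOn f (Icc 0 1))
    (h : ∀ n : ℕ, ∫ x in (0 : ℝ)..1, (x : ℂ) ^ n * f x = 0) : ∀ x ∈ Icc (0 : ℝ) 1, f x = 0 := by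
  have hi : ∀ n : ℕ, IntervalIntegrable (fun x : ℝ => (x : ℂ) ^ n * f x) volume 0 1 := fun n => by
    refine ContinuousOn.intervalIntegrable ?_
    rw [uIcc_of_le zero_le_one]
    exact ContinuousOn.mul (by fun_prop) hf
  have hre := eq_zero_of_real_moments_eq_zero (f := fun x => (f x).re)
    (continuous_re.comp_continuousOn hf) fun n => by
      have := reCLM.intervalIntegral_comp_comm (hi n)
      rw [h n, map_zero] at this
      refine Eq.trans (intervalIntegral.integral_congr fun x _ => ?_) this
      simp [← ofReal_pow]
  have him := eq_zero_of_real_moments_eq_zero (f := fun x => (f x).im)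
    (continuous_im.comp_continuousOn hf) fun n => by
      have := imCLM.intervalIntegral_comp_comm (hi n)
      rw [h n, map_zero] at this
      refine Eq.trans (intervalIntegral.integral_congr fun x _ => ?_) this
      simp [← ofReal_pow]
  exact fun x hx => Complex.ext (hre x hx) (him x hx)

variable {a σ : ℝ}

lemma norm_ofReal_cpow_le_one {x : ℝ} (hx : x ∈ Icc (0 : ℝ) 1) {w : ℂ} (hw : 0 < w.re) :
    ‖(x : ℂ) ^ w‖ ≤ 1 := by
  rw [norm_cpow_eq_rpow_re_of_nonneg hx.1 hw.ne']
  exact Real.rpow_le_one hx.1 hx.2 hw.le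

/-- Since 1/(a+1+n-u) = ∫₀¹ xⁿ x^(a-u) dx, Fubini turns the hypothesis into the vanishing of all
moments of a function continuous on [0,1]. The condition σ < a keeps |x^(a-u)| ≤ 1 there, including
x = 0. -/
lemma integral_mul_cpow_eq_zero (hσ : σ < a) {K : ℝ → ℂ} (hKc : Continuous K)
    (hK : Integrable K)
    (h : ∀ n : ℕ, ∫ t : ℝ, K t * (a + 1 + n - (σ + t * I) : ℂ)⁻¹ = 0) {x : ℝ}
    (hx : x ∈ Icc (0 : ℝ) 1) :
    ∫ t : ℝ, K t * (x : ℂ) ^ (a - (σ + t * I) : ℂ) = 0 := by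
  have hre : ∀ t : ℝ, 0 < (a - (σ + t * I) : ℂ).re := fun t => by simp; linarith
  refine eq_zero_of_moments_eq_zero
    (f := fun x : ℝ => ∫ t : ℝ, K t * (x : ℂ) ^ (a - (σ + t * I) : ℂ)) ?_ ?_ x hx
  · refine continuousOn_of_dominated (bound := fun t => ‖K t‖) ?_ ?_ hK.norm ?_
    · intro x _
      refine AEStronglyMeasurable.mul hKc.aestronglyMeasurable ?_
      exact Measurable.aestronglyMeasurable (by fun_prop)
    · intro x hx
      refine Filter.Eventually.of_forall fun t => ?_
      rw [norm_mul]
      exact mul_le_of_le_one_right (norm_nonneg _) (norm_ofReal_cpow_le_one hx (hre t))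
    · refine Filter.Eventually.of_forall fun t => ?_
      exact ((continuous_ofReal_cpow_const (hre t)).const_mul (K t)).continuousOn
  · intro n
    rw [intervalIntegral.integral_of_le zero_le_one]
    simp only [← integral_const_mul]
    rw [integral_integral_swap]
    · rw [← h n]
      refine integral_congr_ae (Filter.Eventually.of_forall fun t => ?_)
      have e : ∀ x ∈ Ioc (0 : ℝ) 1, (x : ℂ) ^ n * (K t * (x : ℂ) ^ (a - (σ + t * I) : ℂ)) =
          K t * (x : ℂ) ^ (a + n - (σ + t * I) : ℂ) := fun x hx => by
        have hx0 : (x : ℂ) ≠ 0 := by exact_mod_cast hx.1.ne'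
        have : (a + n - (σ + t * I) : ℂ) = n + (a - (σ + t * I)) := by ring
        rw [this, cpow_add _ _ hx0, cpow_natCast]
        ring
      simp only
      rw [setIntegral_congr_fun measurableSet_Ioc e, integral_const_mul,
        ← intervalIntegral.integral_of_le zero_le_one, integral_cpow]
      · have hne : (a + n - (σ + t * I) + 1 : ℂ) ≠ 0 := fun h0 => by
          have := congrArg re h0
          simp at this
          linarith [(Nat.cast_nonneg n : (0 : ℝ) ≤ n)]
        have : (a + 1 + n - (σ + t * I) : ℂ) = a + n - (σ + t * I) + 1 := by ring
        rw [this, ofReal_one, one_cpow, ofReal_zero, zero_cpow hne, sub_zero, one_div]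
      · left
        simp
        linarith [(Nat.cast_nonneg n : (0 : ℝ) ≤ n)]
    · have hdom : Integrable (fun z : ℝ × ℝ => (1 : ℝ) * ‖K z.2‖)
          ((volume.restrict (Ioc (0 : ℝ) 1)).prod volume) :=
        Integrable.mul_prod (f := fun _ : ℝ => (1 : ℝ)) (integrable_const 1) hK.norm
      refine hdom.mono' ?_ ?_
      · refine Measurable.aestronglyMeasurable ?_
        have := hKc.measurable
        unfold Function.uncurry
        fun_prop
      · have : ∀ᵐ z : ℝ × ℝ ∂((volume.restrict (Ioc (0 : ℝ) 1)).prod volume), z.1 ∈ Ioc (0 : ℝ) 1 :=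
          Measure.quasiMeasurePreserving_fst.ae (ae_restrict_mem measurableSet_Ioc)
        filter_upwards [this] with z hz
        have hz' : z.1 ∈ Icc (0 : ℝ) 1 := ⟨hz.1.le, hz.2⟩
        simp only [Function.uncurry]
        rw [norm_mul, norm_mul, norm_pow, norm_real, Real.norm_of_nonneg hz.1.le]
        have h1 : z.1 ^ n ≤ 1 := pow_le_one₀ hz.1.le hz.2
        have h2 := norm_ofReal_cpow_le_one hz' (hre z.2)
        have h3 : ‖K z.2‖ * ‖(z.1 : ℂ) ^ (a - (σ + z.2 * I) : ℂ)‖ ≤ ‖K z.2‖ :=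
          mul_le_of_le_one_right (norm_nonneg _) h2
        exact mul_le_mul h1 h3 (by positivity) zero_le_one

end Moments

/-! ### Continuation to a left half-plane by the Mellin transform -/

section MellinExtension

open Complex Filter Topology Asymptotics MeasureTheory Set FourierTransform

lemma norm_mellinInv_le {K : ℂ → ℂ} (σ : ℝ) {x : ℝ} (hx : 0 < x) :
    ‖mellinInv σ K x‖ ≤ (1 / (2 * Real.pi) * ∫ t : ℝ, ‖K (σ + t * I)‖) * x ^ (-σ) := by
  rw [mellinInv, norm_smul, Real.norm_of_nonneg (by positivity), mul_assoc]
  gcongr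
  refine (norm_integral_le_integral_norm _).trans (le_of_eq ?_)
  rw [← integral_mul_const]
  refine integral_congr_ae (Eventually.of_forall fun t => ?_)
  simp only [smul_eq_mul]
  rw [norm_mul, norm_cpow_eq_rpow_re_of_pos hx, mul_comm]
  simp

lemma mellinInv_eq_of_bound {K : ℂ → ℂ} {σ₁ σ₂ C : ℝ} (h : σ₁ ≤ σ₂)
    (hf : ∀ u : ℂ, σ₁ ≤ u.re → u.re ≤ σ₂ → DifferentiableAt ℂ K u)
    (hb : ∀ u : ℂ, σ₁ ≤ u.re → u.re ≤ σ₂ → ‖K u‖ ≤ C / (1 + u.im ^ 2)) {x : ℝ} (hx : 0 < x) :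
    mellinInv σ₁ K x = mellinInv σ₂ K x := by
  rw [mellinInv, mellinInv]
  congr 1
  refine integral_vertical_eq_of_bound (f := fun u => (x : ℂ) ^ (-u) • K u)
    (C := (x ^ (-σ₁) + x ^ (-σ₂)) * C) h (fun u h1 h2 => ?_) (fun u h1 h2 => ?_)
  · have hpow : DifferentiableAt ℂ (fun u : ℂ => (x : ℂ) ^ (-u)) u :=
      differentiableAt_id.neg.const_cpow (Or.inl (by exact_mod_cast hx.ne'))
    exact hpow.smul (hf u h1 h2)
  · rw [norm_smul, norm_cpow_eq_rpow_re_of_pos hx, mul_div_assoc, neg_re]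
    have h3 : x ^ (-u.re) ≤ x ^ (-σ₁) + x ^ (-σ₂) := by
      rcases le_total 1 x with h1x | h1x
      · have := Real.rpow_le_rpow_of_exponent_le h1x (neg_le_neg h1)
        linarith [Real.rpow_nonneg hx.le (-σ₂)]
      · have := Real.rpow_le_rpow_of_exponent_ge hx h1x (neg_le_neg h2)
        linarith [Real.rpow_nonneg hx.le (-σ₁)]
    exact mul_le_mul h3 (hb u h1 h2) (norm_nonneg _) (by positivity)

/-- If the inverse Mellin transform of `K` vanishes on `(0, 1]`, then `K` extends holomorphically
to a left half-plane. -/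
lemma exists_extension_of_mellinInv_eq_zero {K : ℂ → ℂ} {σ₁ σ₂ C : ℝ} (h : σ₁ < σ₂)
    (hf : ∀ u : ℂ, σ₁ ≤ u.re → u.re ≤ σ₂ → DifferentiableAt ℂ K u)
    (hb : ∀ u : ℂ, σ₁ ≤ u.re → u.re ≤ σ₂ → ‖K u‖ ≤ C / (1 + u.im ^ 2))
    (h0 : ∀ x ∈ Ioc (0 : ℝ) 1, mellinInv σ₁ K x = 0) :
    ∃ L : ℂ → ℂ, (∀ z : ℂ, z.re < σ₂ → DifferentiableAt ℂ L z) ∧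
      ∀ t : ℝ, L (σ₁ + t * I) = K (σ₁ + t * I) := by
  set g : ℝ → ℂ := fun y => K (σ₁ + 2 * Real.pi * y * I) with hg
  set F : ℝ → ℂ := mellinInv σ₁ K with hF
  set B : ℝ := 1 / (2 * Real.pi) * ∫ t : ℝ, ‖K (σ₂ + t * I)‖ with hB
  -- Moving the contour right to σ₂ improves the decay of `F` at infinity.
  have hFb : ∀ x : ℝ, 0 < x → ‖F x‖ ≤ B * x ^ (-σ₂) := fun x hx => by
    rw [hF, mellinInv_eq_of_bound h.le hf hb hx]
    exact norm_mellinInv_le σ₂ hx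
  have hKi : Integrable fun t : ℝ => K (σ₁ + t * I) := integrable_vertical_of_bound
    (fun u hu => hf u hu.ge (hu.le.trans h.le)) (fun u hu => hb u hu.ge (hu.le.trans h.le))
  have hKc : Continuous fun t : ℝ => K (σ₁ + t * I) := continuous_iff_continuousAt.2 fun t =>
    ContinuousAt.comp' (hf _ (by simp) (by simpa using h.le)).continuousAt (by fun_prop)
  have hpi : (2 * Real.pi : ℝ) ≠ 0 := by positivity
  have hgg : g = fun y : ℝ => K (σ₁ + ((2 * Real.pi * y : ℝ) : ℂ) * I) := by
    funext y; simp [hg]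
  have hgi : Integrable g := by
    rw [hgg]
    exact hKi.comp_mul_left' hpi
  have hgc : Continuous g := by
    rw [hgg]
    exact hKc.comp (by fun_prop : Continuous fun y : ℝ => 2 * Real.pi * y)
  have hFg : ∀ x : ℝ, 0 < x → F x = (x : ℂ) ^ (-σ₁ : ℂ) * 𝓕⁻ g (-Real.log x) := fun x hx => by
    rw [hF, mellinInv_eq_fourierInv σ₁ K hx, smul_eq_mul]
  have hexp : ∀ u : ℝ, (Real.exp (-σ₁ * u) : ℂ) * F (Real.exp (-u)) = 𝓕⁻ g u := fun u => by
    rw [hFg _ (Real.exp_pos _), Real.log_exp, neg_neg, ← mul_assoc]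
    have e1 : ((Real.exp (-u) : ℝ) : ℂ) ^ (-σ₁ : ℂ) = ((Real.exp (σ₁ * u) : ℝ) : ℂ) := by
      rw [← ofReal_neg, ← ofReal_cpow (Real.exp_pos _).le, ← Real.exp_mul]
      congr 2
      ring
    rw [e1, ← ofReal_mul, ← Real.exp_add]
    simp
  have hFc : Continuous (𝓕 g) :=
    VectorFourier.fourierIntegral_continuous Real.continuous_fourierChar
      (by exact continuous_inner) hgi
  -- Needed for Fourier inversion: in the variable u = log x the transform vanishes for u ≤ 0 and
  -- decays like exp(-(σ₂-σ₁)u) for u > 0.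
  have hFI : Integrable (𝓕 g) := by
    have hdom : Integrable ((Ioi (0 : ℝ)).indicator fun u => B * Real.exp (-(σ₂ - σ₁) * u)) := by
      rw [integrable_indicator_iff measurableSet_Ioi]
      exact (exp_neg_integrableOn_Ioi 0 (sub_pos.2 h)).const_mul B
    refine hdom.mono' hFc.aestronglyMeasurable (Eventually.of_forall fun u => ?_)
    have e : 𝓕 g u = 𝓕⁻ g (-u) := by rw [Real.fourierInv_eq_fourier_neg, neg_neg]
    rw [e, ← hexp (-u), neg_neg]
    by_cases hu : u ∈ Ioi (0 : ℝ)
    · rw [indicator_of_mem hu, norm_mul, norm_real, Real.norm_of_nonneg (Real.exp_pos _).le]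
      have := hFb (Real.exp u) (Real.exp_pos u)
      rw [← Real.exp_mul] at this
      calc _ ≤ Real.exp (-σ₁ * -u) * (B * Real.exp (u * -σ₂)) := by gcongr
        _ = _ := by
          rw [mul_left_comm, ← Real.exp_add]
          congr 2; ring
    · rw [indicator_of_notMem hu, h0 (Real.exp u) ⟨Real.exp_pos u, Real.exp_le_one_iff.2
        (not_lt.1 hu)⟩]
      simp
  -- `F` vanishes near 0, so convergence is limited only by its decay at infinity, that is by Re z <
  -- σ₂.
  refine ⟨mellin F, fun z hz => ?_, fun t => ?_⟩
  · refine mellin_differentiableAt_of_isBigO_rpow (a := σ₂) (b := z.re - 1) ?_ ?_ hz ?_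
      (by linarith)
    · refine ContinuousOn.locallyIntegrableOn ?_ measurableSet_Ioi
      have hc : ContinuousOn (fun x : ℝ => (x : ℂ) ^ (-σ₁ : ℂ) * 𝓕 g (Real.log x)) (Ioi 0) := by
        refine ContinuousOn.mul (fun x hx => ?_) (hFc.comp_continuousOn
          (Real.continuousOn_log.mono fun x hx => (ne_of_gt hx : x ≠ 0)))
        exact (continuousAt_ofReal_cpow_const x _ (Or.inr (ne_of_gt hx))).continuousWithinAt
      refine hc.congr fun x hx => ?_
      rw [hFg x hx, Real.fourierInv_eq_fourier_neg, neg_neg]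
    · refine IsBigO.of_bound B ?_
      filter_upwards [eventually_gt_atTop 0] with x hx
      rw [Real.norm_of_nonneg (Real.rpow_nonneg hx.le _)]
      exact hFb x hx
    · refine IsBigO.of_bound 0 ?_
      filter_upwards [Ioc_mem_nhdsGT (zero_lt_one : (0 : ℝ) < 1)] with x hx
      simp [h0 x hx]
  · have hfun : (fun u : ℝ => Real.exp (-σ₁ * u) • F (Real.exp (-u))) = 𝓕⁻ g := by
      funext u
      rw [real_smul, hexp]
    rw [mellin_eq_fourier]
    have hre : ((σ₁ : ℂ) + t * I).re = σ₁ := by simp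
    have him : ((σ₁ : ℂ) + t * I).im = t := by simp
    rw [hre, him, hfun, hgc.fourier_fourierInv_eq hgi hFI, hgg]
    simp only
    rw [mul_div_cancel₀ _ hpi]

end MellinExtension

/-! ### Poles of γ forced by the vanishing integrals -/

section PolesOfGammaFactor

open Complex Filter Topology MeasureTheory Set

/-- Each unit step in `a` is one use of the functional equation in numerator and denominator; the
powers of 2π cancel. -/
lemma barnesKernel_add_nat (γ : ℂ → ℂ) {a : ℝ} {u : ℂ} (h1 : -a < u.re) (h2 : u.re < a + 1)
    (k : ℕ) : barnesKernel γ (a + k) u = barnesKernel γ a u *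
      ((∏ i ∈ Finset.range k, (u + a + i)) / ∏ i ∈ Finset.range k, (a + 1 + i - u)) := by
  induction k with
  | zero => simp
  | succ k ih =>
    have hk : (0 : ℝ) ≤ k := k.cast_nonneg
    have n1 : u + a + k ≠ 0 := fun h => by
      have := congrArg re h; simp at this; linarith
    have n2 : (a : ℂ) + 1 + k - u ≠ 0 := fun h => by
      have := congrArg re h; simp at this; linarith
    have step : barnesKernel γ (a + (k + 1 : ℕ)) u =
        barnesKernel γ (a + k) u * ((u + a + k) / (a + 1 + k - u)) := by
      have e1 : u + ((a + (k + 1 : ℕ) : ℝ) : ℂ) = (u + a + k) + 1 := by push_cast; ring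
      have e2 : ((a + (k + 1 : ℕ) : ℝ) : ℂ) + 1 - u = (a + 1 + k - u) + 1 := by push_cast; ring
      have e3 : u + ((a + k : ℝ) : ℂ) = u + a + k := by push_cast; ring
      have e4 : ((a + k : ℝ) : ℂ) + 1 - u = a + 1 + k - u := by push_cast; ring
      have hpi : (Real.pi : ℂ) ≠ 0 := by simp
      rw [barnesKernel, barnesKernel, e1, e2, e3, e4, Gammaℂ_add_one n1, Gammaℂ_add_one n2]
      simp only [div_eq_mul_inv, mul_inv, inv_inv]
      field_simp
    rw [step, ih, Finset.prod_range_succ, Finset.prod_range_succ]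
    simp only [div_eq_mul_inv, mul_inv]
    ring

variable {r : ℕ} {Q : ℝ} {l : Fin r → ℝ} {m : Fin r → ℂ}

/-- Brings the integrals for all λ to the common line Re u = -1, which lies outside the open range
of σ₁ but still left of the poles of γ(-u). -/
lemma integral_barnesKernel_eq_zero (hQ : 0 < Q) (hl : ∀ j, 0 < l j) (hsum : ∑ j, l j = 1)
    (hm : ∀ j, -(1 / 2 : ℝ) * l j < (m j).re) {lam : ℝ}
    (hF : ∃ σ₁ ∈ Ioo ((1 - lam) / 2) (-1 : ℝ),
        mellinBarnes (gammaFactor Q l m) lam 1 1 σ₁ = 0) :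
    ∫ t : ℝ, barnesKernel (gammaFactor Q l m) ((lam - 1) / 2) ((-1 : ℝ) + t * I) = 0 := by
  obtain ⟨σ, ⟨h1, h2⟩, h0⟩ := hF
  simp only [mellinBarnes, mellinBarnesIntegrand_one_one] at h0
  rw [integral_mul_const] at h0
  have hz : ∫ t : ℝ, barnesKernel (gammaFactor Q l m) ((lam - 1) / 2) (σ + t * I) = 0 := by
    simpa [Real.pi_ne_zero] using h0
  obtain ⟨C, -, hC⟩ := barnesKernel_bound (a := (lam - 1) / 2) (σ₁ := σ) (σ₂ := -1) hQ hl hsum hm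
    (by linarith) (by norm_num)
  rw [← hz]
  exact (integral_vertical_eq_of_bound h2.le (fun u hu1 hu2 => differentiableAt_barnesKernel hQ hl
    hm (by linarith) (by linarith)) hC).symm

/-- Vanishing of the Mellin–Barnes integrals forces `γ` to have poles at `1 - a - n`. -/
lemma gammaFactor_eq_zero_of_mellinBarnes (hQ : 0 < Q) (hl : ∀ j, 0 < l j)
    (hsum : ∑ j, l j = 1) (hm : ∀ j, -(1 / 2 : ℝ) * l j < (m j).re) {lam : ℝ} (hlam : 3 < lam)
    (hF : ∀ k : ℕ, ∃ σ₁ ∈ Ioo ((1 - (lam + 2 * k)) / 2) (-1 : ℝ),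
        mellinBarnes (gammaFactor Q l m) (lam + 2 * k) 1 1 σ₁ = 0) (n : ℕ) :
    gammaFactor Q l m (1 - ((lam - 1) / 2 : ℝ) - n) = 0 := by
  set a : ℝ := (lam - 1) / 2 with ha
  have ha1 : 1 < a := by rw [ha]; linarith
  set K : ℂ → ℂ := barnesKernel (gammaFactor Q l m) a with hK
  obtain ⟨C, -, hC⟩ := barnesKernel_bound (a := a) (σ₁ := -1) (σ₂ := -(3 / 4)) hQ hl hsum hm
    (by linarith) (by norm_num)
  have hd : ∀ u : ℂ, -1 ≤ u.re → u.re ≤ -(3 / 4) → DifferentiableAt ℂ K u := fun u h1 h2 =>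
    differentiableAt_barnesKernel hQ hl hm (by linarith) (by linarith)
  have hKi : Integrable fun t : ℝ => K ((-1 : ℝ) + t * I) := integrable_vertical_of_bound
    (C := C) (fun u hu => hd u hu.ge (by linarith)) (fun u hu => hC u hu.ge (by linarith))
  have hKc : Continuous fun t : ℝ => K ((-1 : ℝ) + t * I) := continuous_iff_continuousAt.2 fun t =>
    ContinuousAt.comp' (hd _ (by simp) (by simp; norm_num)).continuousAt (by fun_prop)
  have horth : ∀ k : ℕ, ∫ t : ℝ, K ((-1 : ℝ) + t * I) *
      ((∏ i ∈ Finset.range k, (((-1 : ℝ) : ℂ) + t * I + a + i)) /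
      ∏ i ∈ Finset.range k, (a + 1 + i - (((-1 : ℝ) : ℂ) + t * I))) = 0 := fun k => by
    have hk : (0 : ℝ) ≤ k := k.cast_nonneg
    rw [← integral_barnesKernel_eq_zero hQ hl hsum hm (lam := lam + 2 * k) (hF k)]
    have e : (lam + 2 * k - 1) / 2 = a + k := by rw [ha]; ring
    rw [e]
    refine integral_congr_ae (Eventually.of_forall fun t => ?_)
    simp only
    rw [barnesKernel_add_nat _ (by simp; linarith) (by simp; linarith)]
  have hmom := integral_mul_inv_sub_eq_zero (by linarith : (-1 : ℝ) ≤ a) (by linarith) hKi horth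
  have hinv : ∀ x ∈ Ioc (0 : ℝ) 1, mellinInv (-1) K x = 0 := fun x hx => by
    have h0 := integral_mul_cpow_eq_zero (by linarith : (-1 : ℝ) < a) hKc hKi hmom
      (x := x) ⟨hx.1.le, hx.2⟩
    have hx0 : (x : ℂ) ≠ 0 := by exact_mod_cast hx.1.ne'
    have e : ∀ t : ℝ, K ((-1 : ℝ) + t * I) * (x : ℂ) ^ (a - ((-1 : ℝ) + t * I) : ℂ) =
        (x : ℂ) ^ (a : ℂ) * ((x : ℂ) ^ (-((-1 : ℝ) + t * I) : ℂ) • K ((-1 : ℝ) + t * I)) :=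
      fun t => by
        rw [sub_eq_add_neg, cpow_add _ _ hx0, smul_eq_mul]
        ring
    simp only [e] at h0
    rw [integral_const_mul] at h0
    rw [mellinInv, (mul_eq_zero.1 h0).resolve_left (cpow_ofReal_ne_zero hx.1 _), smul_zero]
  obtain ⟨L, hL, hLK⟩ := exists_extension_of_mellinInv_eq_zero
    (by norm_num : (-1 : ℝ) < -(3 / 4)) hd hC hinv
  set U : Set ℂ := {z | z.re < -(3 / 4)} with hU
  have hUo : IsOpen U := isOpen_lt continuous_re continuous_const
  have hUc : IsPreconnected U := (convex_halfSpace_re_lt _).isPreconnected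
  -- The identity K = L is divided by Γ_ℂ(z+a), so that both sides are holomorphic on all of `U` and
  -- agree there by the identity theorem.
  set φ : ℂ → ℂ := fun z => gammaFactor Q l m (-z) * (Gammaℂ (a + 1 - z))⁻¹ *
    (gammaFactor Q l m (1 + z))⁻¹ with hφ
  set ψ : ℂ → ℂ := fun z => L z * (Gammaℂ (z + a))⁻¹ with hψ
  have hφd : DifferentiableOn ℂ φ U := fun z hz => by
    have d2 : DifferentiableAt ℂ (fun u : ℂ => gammaFactor Q l m (-u)) z :=
      DifferentiableAt.comp (g := gammaFactor Q l m) z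
        (differentiableAt_gammaFactor hQ hl hm (by
          have : z.re < -(3 / 4) := hz
          rw [neg_re]; linarith)) (by fun_prop)
    have d3 : DifferentiableAt ℂ (fun u : ℂ => (Gammaℂ (a + 1 - u))⁻¹) z :=
      DifferentiableAt.comp (g := fun s => (Gammaℂ s)⁻¹) z
        (differentiable_Gammaℂ_inv _) (by fun_prop)
    have d4 : DifferentiableAt ℂ (fun u : ℂ => (gammaFactor Q l m (1 + u))⁻¹) z :=
      DifferentiableAt.comp (g := fun s => (gammaFactor Q l m s)⁻¹) z
        (differentiable_gammaFactor_inv hQ _) (by fun_prop)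
    exact ((d2.mul d3).mul d4).differentiableWithinAt
  have hψd : DifferentiableOn ℂ ψ U := fun z hz => by
    have d3 : DifferentiableAt ℂ (fun u : ℂ => (Gammaℂ (u + a))⁻¹) z :=
      DifferentiableAt.comp (g := fun s => (Gammaℂ s)⁻¹) z
        (differentiable_Gammaℂ_inv _) (by fun_prop)
    exact ((hL z hz).mul d3).differentiableWithinAt
  have hline : ∀ t : ℝ, φ (((-1 : ℝ) : ℂ) + t * I) = ψ (((-1 : ℝ) : ℂ) + t * I) := fun t => by
    simp only [hφ, hψ]
    rw [hLK t, hK, barnesKernel]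
    have hne : Gammaℂ (((-1 : ℝ) : ℂ) + t * I + a) ≠ 0 :=
      Gammaℂ_ne_zero_of_re_pos (by simp; linarith)
    field_simp
  have hfreq : ∃ᶠ z in 𝓝[≠] ((-1 : ℝ) : ℂ), φ z = ψ z := by
    have ht : Tendsto (fun t : ℝ => ((-1 : ℝ) : ℂ) + t * I) (𝓝[≠] 0) (𝓝[≠] ((-1 : ℝ) : ℂ)) := by
      refine tendsto_nhdsWithin_iff.2 ⟨?_, ?_⟩
      · have : Continuous fun t : ℝ => ((-1 : ℝ) : ℂ) + t * I := by fun_prop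
        have h := this.tendsto 0
        simp only [ofReal_zero, zero_mul, add_zero] at h
        exact h.mono_left nhdsWithin_le_nhds
      · filter_upwards [self_mem_nhdsWithin] with t ht
        have ht' : t ≠ 0 := ht
        simp [ht']
    exact ht.frequently (Eventually.of_forall hline).frequently
  have heq := (hφd.analyticOnNhd hUo).eqOn_of_preconnected_of_frequently_eq
    (hψd.analyticOnNhd hUo) hUc (by simp [hU]; norm_num : ((-1 : ℝ) : ℂ) ∈ U) hfreq
  have hn : (0 : ℝ) ≤ n := n.cast_nonneg
  have hzU : (-(a : ℂ) - n) ∈ U := by simp [hU]; linarith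
  have hval := heq hzU
  simp only [hφ, hψ] at hval
  -- This is a pole; the default value 0 makes the inverse equal to 0, which is the true value of
  -- 1/Γ_ℂ.
  have hG : Gammaℂ (-(a : ℂ) - n + a) = 0 := by
    have : -(a : ℂ) - n + a = -n := by ring
    rw [this, Gammaℂ_def, Gamma_neg_nat_eq_zero, mul_zero]
  rw [hG, inv_zero, mul_zero] at hval
  have h1 : gammaFactor Q l m (-(-(a : ℂ) - n)) ≠ 0 :=
    gammaFactor_ne_zero hQ hl hm (by simp; linarith)
  have h2 : (Gammaℂ (a + 1 - (-(a : ℂ) - n)))⁻¹ ≠ 0 :=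
    inv_ne_zero (Gammaℂ_ne_zero_of_re_pos (by simp; linarith))
  have h3 := (mul_eq_zero.1 hval).resolve_left (mul_ne_zero h1 h2)
  rw [inv_eq_zero] at h3
  rw [← h3]
  congr 1
  ring

end PolesOfGammaFactor

/-! ### Entire quotients and polynomial growth -/

section EntireFunctions

open Complex Filter Topology Polynomial

lemma differentiable_dslope {f : ℂ → ℂ} (hf : Differentiable ℂ f) (c : ℂ) :
    Differentiable ℂ (dslope f c) := by
  rw [← differentiableOn_univ] at hf ⊢
  exact (differentiableOn_dslope univ_mem).2 hf

/-- An entire function divided by one with simple zeros contained among its own is entire. -/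
lemma exists_entire_quotient {A B : ℂ → ℂ} (hA : Differentiable ℂ A) (hB : Differentiable ℂ B)
    (h : ∀ p, B p = 0 → A p = 0 ∧ deriv B p ≠ 0) :
    ∃ f : ℂ → ℂ, Differentiable ℂ f ∧ ∀ s, A s = f s * B s := by
  classical
  refine ⟨fun s => if B s = 0 then deriv A s / deriv B s else A s / B s, fun p => ?_, fun s => ?_⟩
  · by_cases hp : B p = 0
    · obtain ⟨hAp, hBp⟩ := h p hp
      have hne : dslope B p p ≠ 0 := by rwa [dslope_same]
      -- Near a common zero p, A/B is the quotient of the divided differences of A and B at p, and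
      -- that of B does not vanish at p.
      have hq : DifferentiableAt ℂ (fun s => dslope A p s / dslope B p s) p :=
        (differentiable_dslope hA p p).fun_div (differentiable_dslope hB p p) hne
      refine hq.congr_of_eventuallyEq ?_
      filter_upwards [(differentiable_dslope hB p).continuous.continuousAt.eventually_ne hne]
        with s hs
      rcases eq_or_ne s p with rfl | hsp
      · simp [hp]
      · have hs0 : s - p ≠ 0 := sub_ne_zero.2 hsp
        rw [dslope_of_ne _ hsp, slope_def_field, hp, sub_zero] at hs
        have hBs : B s ≠ 0 := fun h0 => hs (by rw [h0, zero_div])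
        rw [if_neg hBs, dslope_of_ne _ hsp, dslope_of_ne _ hsp, slope_def_field, slope_def_field,
          hp, hAp]
        field_simp
        simp only [sub_zero]
        ring
    · have hq : DifferentiableAt ℂ (fun s => A s / B s) p := (hA p).fun_div (hB p) hp
      refine hq.congr_of_eventuallyEq ?_
      filter_upwards [hB.continuous.continuousAt.eventually_ne hp] with s hs
      rw [if_neg hs]
  · by_cases hs : B s = 0
    · simp [hs, (h s hs).1]
    · simp [hs]

/-- An entire function of polynomial growth is a polynomial. -/
lemma exists_polynomial_of_growth {f : ℂ → ℂ} (hf : Differentiable ℂ f) {C R : ℝ} {N : ℕ}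
    (h : ∀ z, R ≤ ‖z‖ → ‖f z‖ ≤ C * ‖z‖ ^ N) : ∃ P : ℂ[X], ∀ z, f z = P.eval z := by
  induction N generalizing f C R with
  | zero =>
    obtain ⟨M, hM⟩ := (isCompact_closedBall (0 : ℂ) R).exists_bound_of_continuousOn
      hf.continuous.continuousOn
    have hb : Bornology.IsBounded (Set.range f) := by
      refine isBounded_iff_forall_norm_le.2 ⟨max M C, ?_⟩
      rintro _ ⟨z, rfl⟩
      rcases le_total ‖z‖ R with hz | hz
      · exact le_max_of_le_left (hM z (by simpa using hz))
      · exact le_max_of_le_right (by simpa using h z hz)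
    obtain ⟨c, hc⟩ := hf.exists_const_forall_eq_of_bounded hb
    exact ⟨Polynomial.C c, fun z => by simp [hc]⟩
  | succ N ih =>
    -- The divided difference (f(z) - f(0))/z is entire and grows by one power less.
    obtain ⟨P, hP⟩ := ih (differentiable_dslope hf 0) (C := C + ‖f 0‖) (R := max R 1) (by
      intro z hz
      have h1 : 1 ≤ ‖z‖ := (le_max_right _ _).trans hz
      have h2 := h z ((le_max_left _ _).trans hz)
      have hz0 : z ≠ 0 := norm_pos_iff.1 (by linarith)
      rw [dslope_of_ne _ hz0, slope_def_field, sub_zero, norm_div, div_le_iff₀ (by linarith)]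
      refine (norm_sub_le _ _).trans ?_
      have h3 : 1 ≤ ‖z‖ ^ N * ‖z‖ := by
        rw [← pow_succ]; exact one_le_pow₀ h1
      rw [pow_succ] at h2
      nlinarith [norm_nonneg (f 0)])
    refine ⟨Polynomial.C (f 0) + X * P, fun z => ?_⟩
    have := sub_smul_dslope f 0 z
    rw [sub_zero, smul_eq_mul, hP] at this
    simp only [eval_add, eval_C, eval_mul, eval_X]
    linear_combination -this

end EntireFunctions

/-! ### Bounds for the complex sine -/

section Sine

open Complex

lemma norm_sin_le_exp (z : ℂ) : ‖sin z‖ ≤ Real.exp |z.im| := by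
  rw [sin, norm_div, norm_mul, norm_I, mul_one, Complex.norm_ofNat]
  have h1 : ‖cexp (-z * I)‖ ≤ Real.exp |z.im| := by
    rw [norm_exp]; simp [le_abs_self]
  have h2 : ‖cexp (z * I)‖ ≤ Real.exp |z.im| := by
    rw [norm_exp]; simp [neg_le_abs]
  have := norm_sub_le (cexp (-z * I)) (cexp (z * I))
  linarith

lemma exp_le_norm_sin_of_one_le {z : ℂ} (hz : 1 ≤ |z.im|) :
    Real.exp |z.im| ≤ 4 * ‖sin z‖ := by
  have h1 : ‖cexp (-z * I)‖ = Real.exp z.im := by rw [norm_exp]; simp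
  have h2 : ‖cexp (z * I)‖ = Real.exp (-z.im) := by rw [norm_exp]; simp
  have h3 := abs_norm_sub_norm_le (cexp (-z * I)) (cexp (z * I))
  have h4 : ‖sin z‖ = ‖cexp (-z * I) - cexp (z * I)‖ / 2 := by
    rw [sin, norm_div, norm_mul, norm_I, mul_one, Complex.norm_ofNat]
  have h5 : Real.exp (-|z.im|) ≤ 1 / 2 := by
    rw [Real.exp_neg, inv_le_comm₀ (Real.exp_pos _) (by norm_num)]
    have := Real.add_one_le_exp |z.im|
    norm_num
    linarith
  have h6 : (2 : ℝ) ≤ Real.exp |z.im| := by linarith [Real.add_one_le_exp |z.im|]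
  rw [h1, h2] at h3
  rcases le_total 0 z.im with h0 | h0
  · rw [abs_of_nonneg h0] at *
    have := (le_abs_self _).trans h3
    linarith
  · rw [abs_of_nonpos h0, neg_neg] at *
    have := (neg_le_abs _).trans h3
    linarith

/-- On the vertical lines midway between zeros of the sine, |sin z| = cosh(Im z). -/
lemma exp_le_norm_sin_of_cos_eq_zero {z : ℂ} (hz : Real.cos z.re = 0) :
    Real.exp |z.im| ≤ 4 * ‖sin z‖ := by
  have h1 : |Real.sin z.re| = 1 := by
    have := Real.sin_sq_add_cos_sq z.re
    rw [hz] at this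
    rw [← sq_eq_sq₀ (abs_nonneg _) zero_le_one, sq_abs]
    linarith
  have h2 : ‖sin z‖ = Real.cosh z.im := by
    rw [sin_eq, ← ofReal_cos, hz, ← ofReal_sin, ← ofReal_cosh]
    rw [ofReal_zero, zero_mul, zero_mul, add_zero, norm_mul, norm_real, norm_real,
      Real.norm_eq_abs, h1, one_mul, Real.norm_of_nonneg (Real.cosh_pos _).le]
  rw [h2, ← Real.cosh_abs, Real.cosh_eq]
  linarith [Real.exp_pos |z.im|, Real.exp_pos (-|z.im|)]

end Sine

/-! ### Zeros of 1/Γ and the reflection formula -/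

section GammaReciprocal

open Complex Filter Topology

/-- Differentiating 1/Γ(s) = s/Γ(s+1) carries the claim from -n to -(n+1), starting from 1/Γ(1) = 1
at s = 0. -/
lemma deriv_Gamma_inv_neg_nat_ne_zero (n : ℕ) :
    deriv (fun z => (Gamma z)⁻¹) (-n : ℂ) ≠ 0 := by
  have hrec : ∀ s : ℂ, deriv (fun z => (Gamma z)⁻¹) s =
      (Gamma (s + 1))⁻¹ + s * deriv (fun z => (Gamma z)⁻¹) (s + 1) := fun s => by
    have he : (fun z => (Gamma z)⁻¹) = fun z => z * (Gamma (z + 1))⁻¹ :=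
      funext one_div_Gamma_eq_self_mul_one_div_Gamma_add_one
    conv_lhs => rw [he]
    have hd : HasDerivAt (fun z => (Gamma (z + 1))⁻¹) (deriv (fun z => (Gamma z)⁻¹) (s + 1)) s :=
      (differentiable_one_div_Gamma (s + 1)).hasDerivAt.comp_add_const s 1
    simpa using ((hasDerivAt_id' s).fun_mul hd).deriv
  induction n with
  | zero => rw [hrec]; simp
  | succ n ih =>
    have e : (-(n + 1 : ℕ) : ℂ) + 1 = -n := by push_cast; ring
    rw [hrec, e, Gamma_neg_nat_eq_zero, inv_zero, zero_add]
    refine mul_ne_zero ?_ ih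
    rw [neg_ne_zero]
    exact_mod_cast n.succ_ne_zero

lemma deriv_Gamma_inv_ne_zero {s : ℂ} (hs : Gamma s = 0) :
    deriv (fun z => (Gamma z)⁻¹) s ≠ 0 := by
  obtain ⟨n, rfl⟩ := (Gamma_eq_zero_iff s).1 hs
  exact deriv_Gamma_inv_neg_nat_ne_zero n

lemma deriv_Gamma_inv_affine (a b s : ℂ) :
    deriv (fun z => (Gamma (a * z + b))⁻¹) s =
      a * deriv (fun z => (Gamma z)⁻¹) (a * s + b) := by
  have h1 : HasDerivAt (fun z : ℂ => a * z + b) a s := by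
    simpa using ((hasDerivAt_id s).const_mul a).add_const b
  have h2 := (differentiable_one_div_Gamma (a * s + b)).hasDerivAt.comp s h1
  rw [mul_comm]
  exact h2.deriv

/-- Also valid at poles of Γ(z), where the sine and the inverse of the default value 0 both vanish.
-/
lemma Gamma_inv_eq_reflection {z : ℂ} (h : Gamma (1 - z) ≠ 0) :
    (Gamma z)⁻¹ = Gamma (1 - z) * (sin (Real.pi * z) / Real.pi) := by
  have hr := Gamma_mul_Gamma_one_sub z
  have hpi : (Real.pi : ℂ) ≠ 0 := by simp
  by_cases hs : sin (Real.pi * z) = 0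
  · rw [hs, div_zero] at hr
    rw [(mul_eq_zero.1 hr).resolve_right h, hs]
    simp
  · rw [eq_div_iff hs] at hr
    refine inv_eq_of_mul_eq_one_right ?_
    rw [← mul_assoc, mul_div_assoc', hr, div_self hpi]

end GammaReciprocal

/-! ### The quotient of 1/γ by 1/Γ(s+c) is polynomial up to an exponential -/

section Growth

open Complex Filter Topology Asymptotics

lemma le_exp_mul_pow_of_log_le {x y C ρ : ℝ} {N : ℕ} (hx : 0 < x) (hy : 1 ≤ y) (hN : ρ ≤ N)
    (h : Real.log x ≤ C + ρ * Real.log y) : x ≤ Real.exp C * y ^ N := by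
  have hy0 : 0 < y := by linarith
  have hlog : 0 ≤ Real.log y := Real.log_nonneg hy
  have h1 : Real.log x ≤ C + N * Real.log y := h.trans (by gcongr)
  rw [Real.log_le_iff_le_exp hx, Real.exp_add, mul_comm (N : ℝ), Real.exp_mul,
    Real.exp_log hy0, Real.rpow_natCast] at h1
  exact h1

variable {r : ℕ} {Q : ℝ} {l : Fin r → ℝ} {m : Fin r → ℂ} {c : ℝ} {f : ℂ → ℂ}

/-- On the right f(s) = e^(κs) Γ(s+c)/γ(s), and the factor e^(κs) removes exactly the exponential
part of the ratio. -/
lemma growth_right (hQ : 0 < Q) (hl : ∀ j, 0 < l j) (hsum : ∑ j, l j = 1)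
    (hf : ∀ s, cexp (gammaRate Q l * s) * (gammaFactor Q l m s)⁻¹ = f s * (Gamma (s + c))⁻¹) :
    ∃ (C : ℝ) (N : ℕ), ∀ᶠ s in rightInfty, ‖f s‖ ≤ C * ‖s‖ ^ N := by
  obtain ⟨hne, hO⟩ := log_norm_gammaFactor_sub_isBigO hQ hl hsum m c
  obtain ⟨C, hC⟩ := hO.bound
  set ρ : ℝ := (∑ j, m j).re - r / 2 - c + 1 / 2 with hρ
  obtain ⟨N, hN⟩ := exists_nat_ge (-ρ)
  refine ⟨Real.exp C, N, ?_⟩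
  filter_upwards [hne, hC, tendsto_norm_rightInfty.eventually_ge_atTop 1] with s h1 h2 h3
  have e : f s = cexp (gammaRate Q l * s) * (gammaFactor Q l m s)⁻¹ * Gamma (s + c) := by
    rw [hf, inv_mul_cancel_right₀ h1.2]
  have hpos : 0 < ‖f s‖ := by
    rw [norm_pos_iff, e]
    exact mul_ne_zero (mul_ne_zero (exp_ne_zero _) (inv_ne_zero h1.1)) h1.2
  refine le_exp_mul_pow_of_log_le hpos h3 hN ?_
  rw [norm_one, mul_one, Real.norm_eq_abs] at h2
  have h4 := (abs_le.1 h2).1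
  rw [e, norm_mul, norm_mul, norm_inv, norm_exp, Real.log_mul, Real.log_mul, Real.log_inv,
    Real.log_exp, re_ofReal_mul]
  · linarith
  · exact (Real.exp_pos _).ne'
  · simpa using h1.1
  · simpa using h1.1
  · simpa using h1.2

/-- Reflection turns the gamma quotient at -w into one of the same shape at w, with parameters 1-m_j
and 1-c and the same rate, times sines. The r sines together contribute at most a constant times
exp(π|Im w|), since the `l j` sum to 1. The sine coming from Γ(s+c) is kept on the left because it
may vanish. -/
lemma growth_left (hQ : 0 < Q) (hl : ∀ j, 0 < l j) (hsum : ∑ j, l j = 1)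
    (hf : ∀ s, cexp (gammaRate Q l * s) * (gammaFactor Q l m s)⁻¹ = f s * (Gamma (s + c))⁻¹) :
    ∃ (C : ℝ) (N : ℕ), ∀ᶠ w in rightInfty,
      ‖f (-w)‖ * ‖sin (Real.pi * (-w + c))‖ ≤ C * ‖w‖ ^ N * Real.exp (Real.pi * |w.im|) := by
  set m' : Fin r → ℂ := fun j => 1 - m j with hm'
  obtain ⟨hne, hO⟩ := log_norm_gammaFactor_sub_isBigO hQ hl hsum m' (1 - c)
  obtain ⟨C, hC⟩ := hO.bound
  set ρ : ℝ := (∑ j, m' j).re - r / 2 - (1 - c) + 1 / 2 with hρ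
  obtain ⟨N, hN⟩ := exists_nat_ge ρ
  have hpi := Real.pi_pos
  have hpiC : (Real.pi : ℂ) ≠ 0 := by simp
  refine ⟨Real.pi * Real.exp C * ∏ j, Real.exp (Real.pi * |(m j).im|), N, ?_⟩
  have hnej : ∀ᶠ s in rightInfty, ∀ j, Gamma (l j * s + m' j) ≠ 0 :=
    eventually_all.2 fun j => (hasStirling (hl j) (m' j)).1
  filter_upwards [hne, hnej, hC, tendsto_norm_rightInfty.eventually_ge_atTop 1] with w h1 h1j h2 h3
  have hB : (Gamma (-w + c))⁻¹ =
      Gamma (w + (1 - c : ℝ)) * (sin (Real.pi * (-w + c)) / Real.pi) := by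
    have e : 1 - (-w + c) = w + ((1 - c : ℝ) : ℂ) := by push_cast; ring
    rw [Gamma_inv_eq_reflection (by rw [e]; exact h1.2), e]
  have hA : (gammaFactor Q l m (-w))⁻¹ = gammaFactor Q l m' w *
      ∏ j, (sin (Real.pi * (l j * -w + m j)) / Real.pi) := by
    have e : ∀ j, 1 - (l j * -w + m j) = l j * w + m' j := fun j => by simp only [hm']; ring
    rw [gammaFactor_inv, gammaFactor, cpow_neg, inv_inv, mul_assoc, ← Finset.prod_mul_distrib]
    congr 1
    refine Finset.prod_congr rfl fun j _ => ?_
    rw [Gamma_inv_eq_reflection (by rw [e]; exact h1j j), e]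
  have hmain := congrArg norm (hf (-w))
  rw [hA, hB, norm_mul, norm_mul, norm_mul, norm_mul, norm_div, norm_prod, norm_exp,
    re_ofReal_mul, neg_re, norm_real, Real.norm_of_nonneg hpi.le] at hmain
  have hG : 0 < ‖Gamma (w + (1 - c : ℝ))‖ := norm_pos_iff.2 h1.2
  have hγ : 0 < ‖gammaFactor Q l m' w‖ := norm_pos_iff.2 h1.1
  have hratio : Real.exp (gammaRate Q l * -w.re) * ‖gammaFactor Q l m' w‖ /
      ‖Gamma (w + (1 - c : ℝ))‖ ≤ Real.exp C * ‖w‖ ^ N := by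
    refine le_exp_mul_pow_of_log_le (by positivity) h3 hN ?_
    rw [norm_one, mul_one, Real.norm_eq_abs] at h2
    have h4 := (abs_le.1 h2).2
    rw [Real.log_div (by positivity) hG.ne', Real.log_mul (Real.exp_pos _).ne' hγ.ne',
      Real.log_exp]
    linarith
  have hsin : ∏ j, ‖sin (Real.pi * (l j * -w + m j)) / Real.pi‖ ≤
      (∏ j, Real.exp (Real.pi * |(m j).im|)) * Real.exp (Real.pi * |w.im|) := by
    have e : Real.exp (Real.pi * |w.im|) = ∏ j, Real.exp (Real.pi * (l j * |w.im|)) := by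
      rw [← Real.exp_sum, ← Finset.mul_sum, ← Finset.sum_mul, hsum, one_mul]
    rw [e, ← Finset.prod_mul_distrib]
    refine Finset.prod_le_prod (fun j _ => norm_nonneg _) fun j _ => ?_
    rw [norm_div, norm_real, Real.norm_of_nonneg hpi.le]
    refine (div_le_self (norm_nonneg _) (by linarith [Real.two_le_pi])).trans ?_
    refine (norm_sin_le_exp _).trans ?_
    rw [← Real.exp_add, Real.exp_le_exp, im_ofReal_mul, add_im, im_ofReal_mul, neg_im, abs_mul,
      abs_of_pos hpi, ← mul_add]
    gcongr
    refine (abs_add_le _ _).trans ?_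
    rw [abs_mul, abs_neg, abs_of_pos (hl j)]
    linarith
  have hfin : ‖f (-w)‖ * ‖sin (Real.pi * (-w + c))‖ = Real.pi *
      (Real.exp (gammaRate Q l * -w.re) * ‖gammaFactor Q l m' w‖ / ‖Gamma (w + (1 - c : ℝ))‖) *
      ∏ j, ‖sin (Real.pi * (l j * -w + m j)) / Real.pi‖ := by
    generalize ∏ j, ‖sin (Real.pi * (l j * -w + m j)) / Real.pi‖ = S at hmain
    field_simp at hmain ⊢
    linear_combination -hmain
  rw [hfin]
  calc _ ≤ Real.pi * (Real.exp C * ‖w‖ ^ N) *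
        ((∏ j, Real.exp (Real.pi * |(m j).im|)) * Real.exp (Real.pi * |w.im|)) := by
        gcongr
    _ = _ := by ring

lemma eventually_rightInfty_iff {p : ℂ → Prop} :
    (∀ᶠ s in rightInfty, p s) ↔ ∃ R : ℝ, ∀ s : ℂ, 0 ≤ s.re → R ≤ ‖s‖ → p s := by
  rw [rightInfty, eventually_inf_principal, ← comap_norm_atTop, eventually_comap,
    eventually_atTop]
  constructor
  · rintro ⟨R, hR⟩
    exact ⟨R, fun s hs hn => hR ‖s‖ hn s rfl hs⟩
  · rintro ⟨R, hR⟩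
    exact ⟨R, fun b hb s hs h0 => hR s h0 (hs ▸ hb)⟩

/-- Polynomial growth in the right half-plane, and polynomial growth after multiplication with a
sine of period `2` in the left half-plane, imply polynomial growth. -/
lemma exists_polynomial_of_growth_sin (hfd : Differentiable ℂ f) {C₁ C₂ : ℝ} {N₁ N₂ : ℕ}
    (h₁ : ∀ᶠ s in rightInfty, ‖f s‖ ≤ C₁ * ‖s‖ ^ N₁)
    (h₂ : ∀ᶠ w in rightInfty,
      ‖f (-w)‖ * ‖sin (Real.pi * (-w + c))‖ ≤ C₂ * ‖w‖ ^ N₂ * Real.exp (Real.pi * |w.im|)) :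
    ∃ P : Polynomial ℂ, ∀ z, f z = P.eval z := by
  obtain ⟨R₁, hR₁⟩ := eventually_rightInfty_iff.1 h₁
  obtain ⟨R₂, hR₂⟩ := eventually_rightInfty_iff.1 h₂
  have hpi := Real.pi_pos
  set C : ℝ := max |C₁| (4 * |C₂|) with hC
  have hC0 : 0 ≤ C := le_max_of_le_left (abs_nonneg _)
  set N : ℕ := max N₁ N₂ with hN
  set R : ℝ := max 1 (max R₁ R₂) with hR
  have hRone : 1 ≤ R := le_max_left _ _
  have hRR₁ : R₁ ≤ R := (le_max_left _ _).trans (le_max_right _ _)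
  have hRR₂ : R₂ ≤ R := (le_max_right _ _).trans (le_max_right _ _)
  have hright : ∀ s : ℂ, 0 ≤ s.re → R ≤ ‖s‖ → ‖f s‖ ≤ C * ‖s‖ ^ N := fun s hs hn => by
    refine (hR₁ s hs (hRR₁.trans hn)).trans ?_
    have : ‖s‖ ^ N₁ ≤ ‖s‖ ^ N := pow_le_pow_right₀ (hRone.trans hn) (le_max_left _ _)
    have h2 : C₁ ≤ C := (le_abs_self _).trans (le_max_left _ _)
    calc _ ≤ C * ‖s‖ ^ N₁ := by gcongr
      _ ≤ _ := by gcongr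
  have hleft : ∀ s : ℂ, s.re ≤ 0 → R ≤ ‖s‖ →
      Real.exp (Real.pi * |s.im|) ≤ 4 * ‖sin (Real.pi * (s + c))‖ →
      ‖f s‖ ≤ C * ‖s‖ ^ N := fun s hs hn hsin => by
    have h := hR₂ (-s) (by simpa using hs) (by rw [norm_neg]; exact hRR₂.trans hn)
    rw [neg_neg, norm_neg, neg_im, abs_neg] at h
    have hE := Real.exp_pos (Real.pi * |s.im|)
    have h3 : ‖f s‖ * Real.exp (Real.pi * |s.im|) ≤
        4 * (C₂ * ‖s‖ ^ N₂) * Real.exp (Real.pi * |s.im|) := by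
      calc _ ≤ ‖f s‖ * (4 * ‖sin (Real.pi * (s + c))‖) := by gcongr
        _ = 4 * (‖f s‖ * ‖sin (Real.pi * (s + c))‖) := by ring
        _ ≤ 4 * (C₂ * ‖s‖ ^ N₂ * Real.exp (Real.pi * |s.im|)) := by gcongr
        _ = _ := by ring
    have h4 := le_of_mul_le_mul_right h3 hE
    have : ‖s‖ ^ N₂ ≤ ‖s‖ ^ N := pow_le_pow_right₀ (hRone.trans hn) (le_max_right _ _)
    have h5 : 4 * C₂ ≤ C := (mul_le_mul_of_nonneg_left (le_abs_self _) (by norm_num)).trans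
      (le_max_right _ _)
    calc _ ≤ (4 * C₂) * ‖s‖ ^ N₂ := by linarith
      _ ≤ C * ‖s‖ ^ N₂ := by gcongr
      _ ≤ _ := by gcongr
  have him : ∀ s : ℂ, (Real.pi * (s + c) : ℂ).im = Real.pi * s.im := fun s => by simp
  have hre : ∀ s : ℂ, (Real.pi * (s + c) : ℂ).re = Real.pi * (s.re + c) := fun s => by simp
  have hsin1 : ∀ s : ℂ, 1 ≤ |s.im| →
      Real.exp (Real.pi * |s.im|) ≤ 4 * ‖sin (Real.pi * (s + c))‖ := fun s hs => by
    have := exp_le_norm_sin_of_one_le (z := Real.pi * (s + c)) (by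
      rw [him, abs_mul, abs_of_pos hpi]; nlinarith [Real.two_le_pi])
    rwa [him, abs_mul, abs_of_pos hpi] at this
  have hsin2 : ∀ s : ℂ, ∀ k : ℤ, s.re + c = k + 1 / 2 →
      Real.exp (Real.pi * |s.im|) ≤ 4 * ‖sin (Real.pi * (s + c))‖ := fun s k hs => by
    have := exp_le_norm_sin_of_cos_eq_zero (z := Real.pi * (s + c)) (by
      rw [hre, hs, Real.cos_eq_zero_iff]
      exact ⟨k, by ring⟩)
    rwa [him, abs_mul, abs_of_pos hpi] at this
  -- The margin 3 keeps the rectangle around `s` used below inside Re z ≤ -R; the 4 comes from |z| ≤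
  -- 4|s| on it.
  refine exists_polynomial_of_growth hfd (C := C * 4 ^ N) (R := R + 3) (N := N) fun s hs => ?_
  have hs1 : 1 ≤ ‖s‖ := by linarith
  have hup : C * ‖s‖ ^ N ≤ C * 4 ^ N * ‖s‖ ^ N := by
    have : (1 : ℝ) ≤ 4 ^ N := one_le_pow₀ (by norm_num)
    have h0 : 0 ≤ C * ‖s‖ ^ N := by positivity
    nlinarith
  rcases le_total 0 s.re with h0 | h0
  · exact (hright s h0 (by linarith)).trans hup
  rcases le_total 1 |s.im| with h1 | h1
  · exact (hleft s h0 (by linarith) (hsin1 s h1)).trans hup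
  have hsre : s.re ≤ -R - 2 := by
    have := norm_le_abs_re_add_abs_im s
    rw [abs_of_nonpos h0] at this
    linarith
  set k : ℤ := ⌊s.re + c - 1 / 2⌋ with hk
  have hk1 : (k : ℝ) ≤ s.re + c - 1 / 2 := Int.floor_le _
  have hk2 : s.re + c - 1 / 2 < k + 1 := Int.lt_floor_add_one _
  set x₁ : ℝ := k + 1 / 2 - c with hx₁
  set x₂ : ℝ := k + 3 / 2 - c with hx₂
  -- On the boundary of this rectangle either |Im z| = 1 or Re z + c is a half-integer, so the sine
  -- can be divided out; the maximum principle carries the bound to `s`.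
  set U : Set ℂ := Set.Ioo x₁ x₂ ×ℂ Set.Ioo (-1) 1 with hU
  have hUb : Bornology.IsBounded U := (Metric.isBounded_Ioo _ _).reProdIm (Metric.isBounded_Ioo _ _)
  have hcl : closure U = Set.Icc x₁ x₂ ×ℂ Set.Icc (-1) 1 := by
    rw [hU, closure_reProdIm, closure_Ioo (by rw [hx₁, hx₂]; linarith), closure_Ioo (by norm_num)]
  have hfr : ∀ z ∈ frontier U, ‖f z‖ ≤ C * (4 * ‖s‖) ^ N := by
    intro z hz
    have hzc : z ∈ closure U := frontier_subset_closure hz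
    have hopen : IsOpen U := isOpen_Ioo.reProdIm isOpen_Ioo
    have hzU : z ∉ U := by
      rw [frontier, hopen.interior_eq] at hz
      exact hz.2
    rw [hcl, mem_reProdIm] at hzc
    obtain ⟨⟨a1, a2⟩, a3, a4⟩ := hzc
    have hzre : z.re ≤ -R := by rw [hx₂] at a2; linarith
    have hzn : R ≤ ‖z‖ := by
      have := (neg_le_abs z.re).trans (abs_re_le_norm z)
      linarith
    have hzs : ‖z‖ ≤ 4 * ‖s‖ := by
      have b1 := norm_le_abs_re_add_abs_im z
      have b2 : |z.im| ≤ 1 := abs_le.2 ⟨a3, a4⟩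
      have b3 := (neg_le_abs s.re).trans (abs_re_le_norm s)
      rw [abs_of_nonpos (by linarith : z.re ≤ 0)] at b1
      rw [hx₁] at a1
      linarith
    have hgrid : Real.exp (Real.pi * |z.im|) ≤ 4 * ‖sin (Real.pi * (z + c))‖ := by
      by_cases c1 : 1 ≤ |z.im|
      · exact hsin1 z c1
      · have c2 := abs_lt.1 (not_le.1 c1)
        rcases eq_or_lt_of_le a1 with d1 | d1
        · exact hsin2 z k (by rw [← d1, hx₁]; ring)
        · rcases eq_or_lt_of_le a2 with d2 | d2
          · exact hsin2 z (k + 1) (by rw [d2, hx₂]; push_cast; ring)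
          · exact hzU (mem_reProdIm.2 ⟨⟨d1, d2⟩, c2.1, c2.2⟩) |>.elim
    refine (hleft z (by linarith) hzn hgrid).trans ?_
    gcongr
  have := Complex.norm_le_of_forall_mem_frontier_norm_le hUb hfd.diffContOnCl hfr
    (z := s) (by
      rw [hcl, mem_reProdIm]
      refine ⟨⟨?_, ?_⟩, abs_le.1 h1⟩
      · rw [hx₁]; linarith
      · rw [hx₂]; linarith)
  rwa [mul_pow, ← mul_assoc] at this

/-- If `γ` has poles at all poles of `Γ (s + c)`, then the reciprocal of `γ` is the reciprocal of
`Γ (s + c)`, up to a polynomial and an exponential. -/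
lemma exists_polynomial_gammaFactor_inv (hQ : 0 < Q) (hl : ∀ j, 0 < l j) (hsum : ∑ j, l j = 1)
    (hz : ∀ n : ℕ, gammaFactor Q l m (-c - n) = 0) :
    ∃ P : Polynomial ℂ, ∀ s, (gammaFactor Q l m s)⁻¹ =
      P.eval s * cexp (-(gammaRate Q l * s)) * (Gamma (s + c))⁻¹ := by
  obtain ⟨f, hfd, hf⟩ := exists_entire_quotient
    (A := fun s => cexp (gammaRate Q l * s) * (gammaFactor Q l m s)⁻¹)
    (B := fun s => (Gamma (s + c))⁻¹)
    (Differentiable.mul (by fun_prop) (differentiable_gammaFactor_inv hQ))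
    (differentiable_one_div_Gamma.comp (by fun_prop))
    (fun p hp => by
      rw [inv_eq_zero] at hp
      obtain ⟨n, hn⟩ := (Gamma_eq_zero_iff _).1 hp
      refine ⟨?_, ?_⟩
      · have : p = -c - n := by linear_combination hn
        rw [this, hz n, inv_zero, mul_zero]
      · have := deriv_Gamma_inv_affine 1 c p
        simp only [one_mul] at this
        rw [this]
        exact deriv_Gamma_inv_ne_zero hp)
  obtain ⟨C₁, N₁, h₁⟩ := growth_right hQ hl hsum hf
  obtain ⟨C₂, N₂, h₂⟩ := growth_left hQ hl hsum hf
  obtain ⟨P, hP⟩ := exists_polynomial_of_growth_sin hfd h₁ h₂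
  refine ⟨P, fun s => ?_⟩
  have := hf s
  simp only [hP] at this
  rw [mul_right_comm, ← this, mul_right_comm, ← Complex.exp_add, add_neg_cancel,
    Complex.exp_zero, one_mul]

end Growth

/-! ### Determination of γ from its poles -/

section Classification

open Complex Filter Topology Polynomial

variable {r : ℕ} {Q : ℝ} {l : Fin r → ℝ} {m : Fin r → ℂ} {c : ℝ}

lemma gammaFactor_eq_zero_iff (hQ : 0 < Q) {s : ℂ} :
    gammaFactor Q l m s = 0 ↔ ∃ j, Gamma (l j * s + m j) = 0 := by
  rw [gammaFactor, mul_eq_zero, or_iff_right (cpow_ofReal_ne_zero hQ s), Finset.prod_eq_zero_iff]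
  simp

lemma deriv_mul_of_right_eq_zero {u v : ℂ → ℂ} {p : ℂ} (hu : DifferentiableAt ℂ u p)
    (hv : DifferentiableAt ℂ v p) (h : v p = 0) :
    deriv (fun s => u s * v s) p = u p * deriv v p := by
  rw [deriv_fun_mul hu hv, h, mul_zero, zero_add]

/-- Each 1/Γ(l_k s + m_k) has only simple zeros, so a multiple zero of the product needs two factors
vanishing together. -/
lemma deriv_gammaFactor_inv_eq_zero_iff (hQ : 0 < Q) (hl : ∀ j, 0 < l j) {p : ℂ} {j : Fin r}
    (hj : Gamma (l j * p + m j) = 0) :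
    deriv (fun s => (gammaFactor Q l m s)⁻¹) p = 0 ↔ ∃ k, k ≠ j ∧ Gamma (l k * p + m k) = 0 := by
  have he : (fun s => (gammaFactor Q l m s)⁻¹) = fun s => (((Q : ℂ) ^ s)⁻¹ *
      ∏ k ∈ Finset.univ.erase j, (Gamma (l k * s + m k))⁻¹) * (Gamma (l j * s + m j))⁻¹ := by
    funext s
    rw [gammaFactor_inv, mul_assoc, Finset.prod_erase_mul _ _ (Finset.mem_univ j)]
  have hd : ∀ k, Differentiable ℂ fun s : ℂ => (Gamma (l k * s + m k))⁻¹ := fun k =>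
    differentiable_one_div_Gamma.comp (by fun_prop)
  have hu : Differentiable ℂ fun s : ℂ => ((Q : ℂ) ^ s)⁻¹ *
      ∏ k ∈ Finset.univ.erase j, (Gamma (l k * s + m k))⁻¹ :=
    ((differentiable_cpow_ofReal hQ).inv (cpow_ofReal_ne_zero hQ)).mul
      (Differentiable.fun_finsetProd fun k _ => hd k)
  have hlj : (l j : ℂ) ≠ 0 := by exact_mod_cast (hl j).ne'
  rw [he, deriv_mul_of_right_eq_zero (hu p) (hd j p) (by rw [hj, inv_zero]),
    deriv_Gamma_inv_affine, mul_eq_zero,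
    or_iff_left (mul_ne_zero hlj (deriv_Gamma_inv_ne_zero hj)), mul_eq_zero,
    or_iff_right (inv_ne_zero (cpow_ofReal_ne_zero hQ p)), Finset.prod_eq_zero_iff]
  simp

lemma deriv_eval_mul_exp_mul_Gamma_inv (P : ℂ[X]) (κ : ℝ) {p : ℂ} (hp : Gamma (p + c) = 0) :
    deriv (fun s => P.eval s * cexp (-(κ * s)) * (Gamma (s + c))⁻¹) p =
      P.eval p * cexp (-(κ * p)) * deriv (fun z => (Gamma z)⁻¹) (p + c) := by
  have hG : Differentiable ℂ fun s : ℂ => (Gamma (s + c))⁻¹ :=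
    differentiable_one_div_Gamma.comp (by fun_prop)
  have hd := deriv_Gamma_inv_affine 1 c p
  simp only [one_mul] at hd
  rw [deriv_mul_of_right_eq_zero (P.differentiableAt.fun_mul (by fun_prop)) (hG p)
    (by rw [hp, inv_zero]), hd]

/-- Far to the left the poles of the j-th factor avoid the zeros of `P`, hence are of the form -c-k.
Two consecutive ones, with spacing 1/l_j, give `q` and then `d`. -/
lemma exists_int_of_gammaFactor_inv (hl : ∀ j, 0 < l j) (hQ : 0 < Q)
    (hm : ∀ j, -(1 / 2 : ℝ) * l j < (m j).re) (hc : c ≤ 3 / 2) {P : ℂ[X]} (hP0 : P ≠ 0) {κ : ℝ}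
    (hP : ∀ s, (gammaFactor Q l m s)⁻¹ = P.eval s * cexp (-(κ * s)) * (Gamma (s + c))⁻¹)
    (j : Fin r) :
    ∃ q d : ℤ, 0 < q ∧ l j * q = 1 ∧ m j = l j * (c + d) ∧ -1 ≤ d := by
  have hlj : (l j : ℂ) ≠ 0 := by exact_mod_cast (hl j).ne'
  set z : ℕ → ℂ := fun n => -(m j + n) / l j with hz
  have hinj : Function.Injective z := fun a b hab => by
    simp only [hz] at hab
    rw [div_left_inj' hlj, neg_inj, add_right_inj] at hab
    exact_mod_cast hab
  have hfin : {n | P.eval (z n) = 0}.Finite := by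
    have : {n | P.eval (z n) = 0} = z ⁻¹' {w | P.IsRoot w} := rfl
    rw [this]
    exact (Polynomial.finite_setOfPred_isRoot hP0).preimage hinj.injOn
  obtain ⟨N, hN⟩ := hfin.bddAbove
  have hpole : ∀ n, N < n → ∃ k : ℕ, z n = -c - k := fun n hn => by
    have hne : P.eval (z n) ≠ 0 := fun h => absurd (hN h) (not_le.2 hn)
    have hγ : gammaFactor Q l m (z n) = 0 := (gammaFactor_eq_zero_iff hQ).2 ⟨j, by
      rw [Gamma_eq_zero_iff]
      exact ⟨n, by simp only [hz]; field_simp; ring⟩⟩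
    have h := hP (z n)
    rw [hγ, inv_zero] at h
    have hG := (mul_eq_zero.1 h.symm).resolve_left (mul_ne_zero hne (exp_ne_zero _))
    rw [inv_eq_zero, Gamma_eq_zero_iff] at hG
    obtain ⟨k, hk⟩ := hG
    exact ⟨k, by linear_combination hk⟩
  obtain ⟨k₁, hk₁⟩ := hpole (N + 1) (by omega)
  obtain ⟨k₂, hk₂⟩ := hpole (N + 2) (by omega)
  simp only [hz] at hk₁ hk₂
  push_cast at hk₁ hk₂
  rw [div_eq_iff hlj] at hk₁ hk₂
  have hq : (l j : ℂ) * (k₂ - k₁) = 1 := by linear_combination hk₂ - hk₁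
  have hqR : l j * ((k₂ : ℝ) - k₁) = 1 := by exact_mod_cast hq
  have hmj : m j = l j * (c + (k₁ - (N + 1) * (k₂ - k₁))) := by
    linear_combination -hk₁ + (N + 1) * hq
  refine ⟨k₂ - k₁, k₁ - (N + 1) * (k₂ - k₁), ?_, by exact_mod_cast hqR, by exact_mod_cast hmj, ?_⟩
  · have : (0 : ℝ) < (k₂ : ℝ) - k₁ := by
      by_contra hneg
      nlinarith [hl j]
    exact_mod_cast this
  · set d : ℤ := k₁ - (N + 1) * (k₂ - k₁) with hd
    have hmd : m j = ((l j * (c + d) : ℝ) : ℂ) := by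
      rw [hmj, hd]; push_cast; ring
    have h1 := hm j
    rw [hmd, ofReal_re] at h1
    -- The bound on Re(m_j) enters here; with c ≤ 3/2 it leaves d > -2.
    have h2 : -(1 / 2 : ℝ) < c + d := by nlinarith [hl j]
    have h3 : (-2 : ℝ) < d := by linarith
    have h4 : (-2 : ℤ) < d := by exact_mod_cast h3
    omega

/-- If factors j and k share a pole at s, they share one at each s - t·q_j·q_k. Since 1/Γ(s+c) has
simple zeros, `P` would vanish at all of these points. -/
lemma deriv_gammaFactor_inv_ne_zero (hl : ∀ j, 0 < l j) (hQ : 0 < Q)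
    (hm : ∀ j, -(1 / 2 : ℝ) * l j < (m j).re) (hc : c ≤ 3 / 2) {P : ℂ[X]} (hP0 : P ≠ 0) {κ : ℝ}
    (hP : ∀ s, (gammaFactor Q l m s)⁻¹ = P.eval s * cexp (-(κ * s)) * (Gamma (s + c))⁻¹)
    {s : ℂ} (hs : gammaFactor Q l m s = 0) :
    deriv (fun s => (gammaFactor Q l m s)⁻¹) s ≠ 0 := by
  obtain ⟨j, hj⟩ := (gammaFactor_eq_zero_iff hQ).1 hs
  rw [Ne, deriv_gammaFactor_inv_eq_zero_iff hQ hl hj]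
  rintro ⟨k, hkj, hk⟩
  obtain ⟨qj, dj, hqj, hlj, -, -⟩ := exists_int_of_gammaFactor_inv hl hQ hm hc hP0 hP j
  obtain ⟨qk, dk, hqk, hlk, -, -⟩ := exists_int_of_gammaFactor_inv hl hQ hm hc hP0 hP k
  lift qj to ℕ using hqj.le
  lift qk to ℕ using hqk.le
  have hljC : (l j : ℂ) * qj = 1 := by exact_mod_cast hlj
  have hlkC : (l k : ℂ) * qk = 1 := by exact_mod_cast hlk
  rw [Gamma_eq_zero_iff] at hj hk
  obtain ⟨a, ha⟩ := hj
  obtain ⟨b, hb⟩ := hk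
  have hroot : ∀ t : ℕ, P.eval (s - t * (qj * qk)) = 0 := fun t => by
    set w : ℂ := s - t * (qj * qk) with hw
    have hj' : Gamma (l j * w + m j) = 0 := by
      rw [Gamma_eq_zero_iff]
      refine ⟨a + t * qk, ?_⟩
      push_cast
      linear_combination ha - t * qk * hljC
    have hk' : Gamma (l k * w + m k) = 0 := by
      rw [Gamma_eq_zero_iff]
      refine ⟨b + t * qj, ?_⟩
      push_cast
      linear_combination hb - t * qj * hlkC
    by_contra hne
    have hd0 := (deriv_gammaFactor_inv_eq_zero_iff hQ hl hj').2 ⟨k, hkj, hk'⟩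
    have hγ := (gammaFactor_eq_zero_iff (Q := Q) hQ).2 ⟨j, hj'⟩
    have h := hP w
    rw [hγ, inv_zero] at h
    have hu : P.eval w * cexp (-(κ * w)) ≠ 0 := mul_ne_zero hne (exp_ne_zero _)
    have hG := (mul_eq_zero.1 h.symm).resolve_left hu
    rw [inv_eq_zero] at hG
    rw [funext hP, deriv_eval_mul_exp_mul_Gamma_inv P κ hG] at hd0
    exact (mul_ne_zero hu (deriv_Gamma_inv_ne_zero hG)) hd0
  have hqq : (qj * qk : ℂ) ≠ 0 := by
    intro h0
    rcases mul_eq_zero.1 h0 with h0 | h0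
    · rw [h0, mul_zero] at hljC; exact zero_ne_one hljC
    · rw [h0, mul_zero] at hlkC; exact zero_ne_one hlkC
  refine hP0 (Polynomial.eq_zero_of_infinite_isRoot P ?_)
  refine (Set.infinite_range_of_injective (f := fun t : ℕ => s - t * (qj * qk : ℂ)) ?_).mono ?_
  · intro t₁ t₂ h
    have := mul_right_cancel₀ hqq (sub_right_injective h)
    exact_mod_cast this
  · rintro _ ⟨t, rfl⟩
    exact hroot t

/-- A zero z of `P` is a pole of γ, so z + c = -(d + nq) with d + nq ≥ -1. If d + nq ≥ 0, then
Γ(s+c) has a pole there too and 1/γ a multiple zero, which is excluded. -/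
lemma eval_eq_zero_imp (hl : ∀ j, 0 < l j) (hQ : 0 < Q)
    (hm : ∀ j, -(1 / 2 : ℝ) * l j < (m j).re) (hc : c ≤ 3 / 2) {P : ℂ[X]} (hP0 : P ≠ 0) {κ : ℝ}
    (hP : ∀ s, (gammaFactor Q l m s)⁻¹ = P.eval s * cexp (-(κ * s)) * (Gamma (s + c))⁻¹)
    {z : ℂ} (hz : P.eval z = 0) : z = 1 - c := by
  have hγ : gammaFactor Q l m z = 0 := by
    have := hP z
    rwa [hz, zero_mul, zero_mul, inv_eq_zero] at this
  have hd := deriv_gammaFactor_inv_ne_zero hl hQ hm hc hP0 hP hγ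
  obtain ⟨j, hj⟩ := (gammaFactor_eq_zero_iff hQ).1 hγ
  obtain ⟨n, hn⟩ := (Gamma_eq_zero_iff _).1 hj
  obtain ⟨q, d, hq, hlq, hmd, hd1⟩ := exists_int_of_gammaFactor_inv hl hQ hm hc hP0 hP j
  have hlqC : (l j : ℂ) * q = 1 := by exact_mod_cast hlq
  have hze : z + c = -((d + n * q : ℤ) : ℂ) := by
    push_cast
    linear_combination q * hn - q * hmd - (z + c + d) * hlqC
  rcases lt_or_ge (d + n * q) 0 with h | h
  · have hnq : 0 ≤ n * q := by positivity
    have : d + n * q = -1 := by omega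
    rw [this] at hze
    push_cast at hze
    linear_combination hze
  · exfalso
    obtain ⟨e, he⟩ := Int.eq_ofNat_of_zero_le h
    have hG : Gamma (z + c) = 0 := by
      rw [Gamma_eq_zero_iff]
      exact ⟨e, by rw [hze, he]; simp⟩
    rw [funext hP, deriv_eval_mul_exp_mul_Gamma_inv P κ hG, hz] at hd
    simp at hd

/-- `P` is constant or has 1-c as its only zero. That zero is simple because the poles of γ are, and
the factor s+c-1 turns 1/Γ(s+c) into 1/Γ(s+c-1). -/
lemma exists_gammaFactor_inv_eq (hl : ∀ j, 0 < l j) (hQ : 0 < Q) (hsum : ∑ j, l j = 1)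
    (hm : ∀ j, -(1 / 2 : ℝ) * l j < (m j).re) (hc : c ≤ 3 / 2)
    (hz : ∀ n : ℕ, gammaFactor Q l m (-c - n) = 0) :
    (∀ j, ∃ x : ℝ, m j = x) ∧ ∃ c' : ℝ, (c' = c ∨ c' = c - 1) ∧ ∃ A : ℂ, ∀ s,
      (gammaFactor Q l m s)⁻¹ = A * cexp (-(gammaRate Q l * s)) * (Gamma (s + c'))⁻¹ := by
  obtain ⟨P, hP⟩ := exists_polynomial_gammaFactor_inv hQ hl hsum hz
  have hP0 : P ≠ 0 := by
    rintro rfl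
    have := hP 1
    rw [eval_zero, zero_mul, zero_mul, inv_eq_zero] at this
    exact gammaFactor_ne_zero hQ hl hm (by norm_num) this
  refine ⟨fun j => ?_, ?_⟩
  · obtain ⟨q, d, -, -, h, -⟩ := exists_int_of_gammaFactor_inv hl hQ hm hc hP0 hP j
    exact ⟨l j * (c + d), by rw [h]; push_cast; ring⟩
  have hconst : ∀ R : ℂ[X], (∀ z, R.eval z ≠ 0) → ∃ A, R = C A := fun R hR => by
    by_contra hne
    have hdeg : R.degree ≠ 0 := fun h => hne ⟨_, eq_C_of_degree_eq_zero h⟩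
    obtain ⟨z, hz⟩ := IsAlgClosed.exists_root R hdeg
    exact hR z hz
  have hroot : ∀ z, P.eval z = 0 → z = 1 - c := fun z h =>
    eval_eq_zero_imp hl hQ hm hc hP0 hP h
  by_cases h1 : P.eval (1 - c : ℂ) = 0
  · obtain ⟨R, hR⟩ := dvd_iff_isRoot.2 h1
    have hR1 : R.eval (1 - c : ℂ) ≠ 0 := fun h0 => by
      have hγ : gammaFactor Q l m (1 - c) = 0 := by
        have := hP (1 - c)
        rwa [h1, zero_mul, zero_mul, inv_eq_zero] at this
      refine deriv_gammaFactor_inv_ne_zero hl hQ hm hc hP0 hP hγ ?_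
      have he : (fun s => (gammaFactor Q l m s)⁻¹) = fun s =>
          (s - (1 - c)) * (R.eval s * cexp (-(gammaRate Q l * s)) * (Gamma (s + c))⁻¹) := by
        funext s
        rw [hP, hR]
        simp only [eval_mul, eval_sub, eval_X, eval_C]
        ring
      have hG : Differentiable ℂ fun s : ℂ => (Gamma (s + c))⁻¹ :=
        differentiable_one_div_Gamma.comp (by fun_prop)
      rw [he, deriv_mul_of_right_eq_zero (by fun_prop)
        ((R.differentiableAt.fun_mul (by fun_prop)).fun_mul (hG _)) (by simp [h0])]
      simp
    obtain ⟨A, rfl⟩ := hconst R fun z h0 => by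
      have : P.eval z = 0 := by rw [hR, eval_mul, h0, mul_zero]
      rw [hroot z this] at h0
      exact hR1 h0
    refine ⟨c - 1, Or.inr rfl, A, fun s => ?_⟩
    rw [hP, hR, one_div_Gamma_eq_self_mul_one_div_Gamma_add_one (s + ((c - 1 : ℝ) : ℂ))]
    have e : s + ((c - 1 : ℝ) : ℂ) + 1 = s + c := by push_cast; ring
    rw [e]
    simp only [eval_mul, eval_sub, eval_X, eval_C]
    push_cast
    ring
  · obtain ⟨A, rfl⟩ := hconst P fun z h0 => by
      rw [hroot z h0] at h0
      exact h1 h0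
    exact ⟨c, Or.inl rfl, A, fun s => by rw [hP, eval_C]⟩

lemma gammaFactor_eq_of_inv_eq (hQ : 0 < Q) (hl : ∀ j, 0 < l j)
    (hm : ∀ j, -(1 / 2 : ℝ) * l j < (m j).re) (hreal : ∀ j, ∃ x : ℝ, m j = x) (hc : -2 < c)
    {A : ℂ} {κ : ℝ}
    (hA : ∀ s, (gammaFactor Q l m s)⁻¹ = A * cexp (-(κ * s)) * (Gamma (s + c))⁻¹) :
    ∃ C H : ℝ, 0 < C ∧ 0 < H ∧ ∀ s : ℂ,
      gammaFactor Q l m s = (C : ℂ) * (H : ℂ) ^ s * Gammaℂ (s + c) := by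
  choose x hx using hreal
  obtain rfl : m = fun j => (x j : ℂ) := funext hx
  have hval : ∀ s, gammaFactor Q l (fun j => (x j : ℂ)) s = A⁻¹ * cexp (κ * s) * Gamma (s + c) :=
    fun s => by
      rw [← inv_inv (gammaFactor Q l _ s), hA, mul_inv, mul_inv, inv_inv, ← Complex.exp_neg, neg_neg]
  obtain ⟨B, hB, hAB⟩ : ∃ B : ℝ, 0 < B ∧ A⁻¹ = B := by
    -- Evaluating at s = 2 shows that the constant is positive: every gamma value involved has a
    -- positive real argument, as c > -2 and the m_j are real.
    have h2 := hval 2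
    have hγ : gammaFactor Q l (fun j => (x j : ℂ)) 2 =
        ((Q ^ (2 : ℝ) * ∏ j, Real.Gamma (l j * 2 + x j) : ℝ) : ℂ) := by
      rw [gammaFactor]
      push_cast [ofReal_cpow hQ.le, ← Gamma_ofReal]
      rfl
    have hpos : ∀ j, 0 < l j * 2 + x j := fun j => by
      have := hm j
      simp only [ofReal_re] at this
      linarith [hl j]
    have hγpos : 0 < Q ^ (2 : ℝ) * ∏ j, Real.Gamma (l j * 2 + x j) :=
      mul_pos (Real.rpow_pos_of_pos hQ _)
        (Finset.prod_pos fun j _ => Real.Gamma_pos_of_pos (hpos j))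
    have hD : cexp (κ * 2) * Gamma (2 + c) =
        ((Real.exp (κ * 2) * Real.Gamma (2 + c) : ℝ) : ℂ) := by
      push_cast [← Gamma_ofReal]
      rfl
    have hDpos : 0 < Real.exp (κ * 2) * Real.Gamma (2 + c) :=
      mul_pos (Real.exp_pos _) (Real.Gamma_pos_of_pos (by linarith))
    refine ⟨_, div_pos hγpos hDpos, ?_⟩
    rw [ofReal_div, ← hγ, ← hD, h2, mul_assoc, mul_div_cancel_right₀]
    rw [hD]
    exact_mod_cast hDpos.ne'
  have hpi : 0 < 2 * Real.pi := by positivity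
  have hpiC : (2 * (Real.pi : ℂ)) ≠ 0 := by simp
  -- Chosen to absorb the factor 2(2π)^(-(s+c)) of Γ_ℂ(s+c).
  refine ⟨B * (2 * Real.pi) ^ c / 2, 2 * Real.pi * Real.exp κ, by positivity, by positivity,
    fun s => ?_⟩
  have hH : ((2 * Real.pi * Real.exp κ : ℝ) : ℂ) ^ s = (2 * (Real.pi : ℂ)) ^ s * cexp (κ * s) := by
    rw [ofReal_mul, mul_cpow_ofReal_nonneg hpi.le (Real.exp_pos _).le]
    congr 1
    · push_cast; rfl
    · rw [cpow_def_of_ne_zero (by exact_mod_cast (Real.exp_pos κ).ne'),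
        ← ofReal_log (Real.exp_pos κ).le, Real.log_exp]
  have hC : ((B * (2 * Real.pi) ^ c / 2 : ℝ) : ℂ) = B * (2 * (Real.pi : ℂ)) ^ (c : ℂ) / 2 := by
    push_cast [ofReal_cpow hpi.le]
    rfl
  have hpow : (2 * (Real.pi : ℂ)) ^ (c : ℂ) * (2 * (Real.pi : ℂ)) ^ s *
      (2 * (Real.pi : ℂ)) ^ (-(s + c)) = 1 := by
    rw [← cpow_add _ _ hpiC, ← cpow_add _ _ hpiC]
    have : (c : ℂ) + s + -(s + c) = 0 := by ring
    rw [this, cpow_zero]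
  rw [hval, hAB, hH, hC, Gammaℂ_def]
  linear_combination (-(B * cexp (κ * s) * Gamma (s + c))) * hpow

end Classification

/-! ### Conclusion -/

/-- The value of `mellinBarnes` does not depend on the admissible line `Re u = σ₁`; the hypothesis
only asks that it vanish for one admissible line for each `lam`. -/
theorem mainTheorem3 {r : ℕ} (Q : ℝ) (hQ : 0 < Q)
    (l : Fin r → ℝ) (hl : ∀ j, 0 < l j)
    (μ : Fin r → ℂ) (hμ : ∀ j, -(1 / 2 : ℝ) * l j < (μ j).re)
    (hsum : ∑ j, l j = 1)
    (δ : ℤ) (hδ : Odd δ)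
    (hF : ∀ lam : ℝ, 9 / 2 ≤ lam → TwiceModFour lam δ →
      ∃ σ₁ ∈ Set.Ioo ((1 - lam) / 2) (-1 : ℝ),
        mellinBarnes (gammaFactor Q l μ) lam 1 1 σ₁ = 0) :
    ∃ ν ∈ ({1 / 2, 3 / 2, 5 / 2, 7 / 2} : Set ℝ), TwiceModFour ν δ ∧
      ∃ C H : ℝ, 0 < C ∧ 0 < H ∧
        ∀ s : ℂ, gammaFactor Q l μ s =
          (C : ℂ) * (H : ℂ) ^ s * Complex.Gammaℂ (s + ((ν : ℂ) - 1) / 2) := by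
  -- Here k₀ = 2λ for the smallest λ used, and c = (λ-1)/2 - 1. Solving (ν-1)/2 = c gives 2ν = k₀ -
  -- 4, and c-1 in place of c gives 2ν = k₀ - 8. The bound k₀ ≤ 12 is the condition c ≤ 3/2.
  have key : ∀ k₀ : ℤ, k₀ ≡ δ [ZMOD 4] → 9 ≤ k₀ → k₀ ≤ 12 →
      ∃ k : ℤ, (k = k₀ - 4 ∨ k = k₀ - 8) ∧ ∃ C H : ℝ, 0 < C ∧ 0 < H ∧
        ∀ s : ℂ, gammaFactor Q l μ s =
          (C : ℂ) * (H : ℂ) ^ s * Complex.Gammaℂ (s + (((k / 2 : ℝ) : ℂ) - 1) / 2) := by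
    intro k₀ hk₀ h9 h12
    have h9' : (9 : ℝ) ≤ k₀ := by exact_mod_cast h9
    have h12' : (k₀ : ℝ) ≤ 12 := by exact_mod_cast h12
    have hz := gammaFactor_eq_zero_of_mellinBarnes hQ hl hsum hμ (lam := k₀ / 2) (by linarith)
      fun n => hF _ (by have : (0 : ℝ) ≤ n := n.cast_nonneg; linarith)
        ⟨k₀ + 4 * n, by push_cast; ring, by
          simpa [Int.ModEq] using hk₀⟩
    obtain ⟨hreal, c', hc', A, hA⟩ := exists_gammaFactor_inv_eq (c := ((k₀ : ℝ) / 2 - 3) / 2) hl hQ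
      hsum hμ (by linarith) fun n => by
        rw [← hz n]
        congr 1
        push_cast
        ring
    obtain ⟨C, H, hC, hH, h⟩ := gammaFactor_eq_of_inv_eq hQ hl hμ hreal
      (by rcases hc' with rfl | rfl <;> linarith) hA
    rcases hc' with rfl | rfl
    · refine ⟨k₀ - 4, Or.inl rfl, C, H, hC, hH, fun s => ?_⟩
      rw [h s]
      congr 2
      push_cast
      ring
    · refine ⟨k₀ - 8, Or.inr rfl, C, H, hC, hH, fun s => ?_⟩
      rw [h s]
      congr 2
      push_cast
      ring
  have hmod : δ % 4 = 1 ∨ δ % 4 = 3 := by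
    have := Int.odd_iff.1 hδ
    omega
  rcases hmod with hd | hd
  · obtain ⟨k, hk, h⟩ := key 9 (by simp [Int.ModEq, hd]) (by norm_num) (by norm_num)
    refine ⟨k / 2, ?_, ⟨k, by ring, ?_⟩, h⟩
    · rcases hk with rfl | rfl <;> norm_num
    · rcases hk with rfl | rfl <;> simp [Int.ModEq, hd]
  · obtain ⟨k, hk, h⟩ := key 11 (by simp [Int.ModEq, hd]) (by norm_num) (by norm_num)
    refine ⟨k / 2, ?_, ⟨k, by ring, ?_⟩, h⟩
    · rcases hk with rfl | rfl <;> norm_num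
    · rcases hk with rfl | rfl <;> simp [Int.ModEq, hd]
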